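/- An instance of Edge-Disjoint Paths (EDP) consists of a finite simple undirected graph $G$ and an ordered multiset $\mathcal X=\{(s_1,t_1),\dots,(s_k,t_k)\}$ of $k$ pairs of distinct vertices of $G$; it is a Yes-instance if $G$ contains pairwise edge-disjoint paths $P_1,\dots,P_k$ such that $P_i$ is an $(s_i,t_i)$-path for every $i$. A block of a graph is a maximal connected subgraph that has no cut vertex of its own, and a block graph is a (non-empty) connected graph in which the vertex set of every block is a clique. Theorem. EDP on block graphs, parameterized by $k$, admits a kernel with at most $4k^2-2k$ vertices. That is, there is an algorithm that, given an EDP instance $(G,\mathcal X)$ with $k$ terminal pairs in which $G$ is a block graph, computes, in time polynomial in the size of the instance, an EDP instance $(G',\mathcal X')$ with $k'\le k$ terminal pairs in which $G'$ is a block graph, such that $(G',\mathcal X')$ is a Yes-instance if and only if $(G,\mathcal X)$ is, and such that, if $k\ge 1$, the graph $G'$ has at most $4k^2-2k$ vertices and at most $4k-2$ blocks, each of which has at most $k$ vertices. (If $k=0$, then $G'$ is a single vertex.) -/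

import Mathlib

namespace EDPKernel

/-! ## Cut vertices, blocks, block graphs -/

/-- A vertex is a cut vertex if removing it increases the number of connected components. -/
def IsCutVertex {V : Type*} (G : SimpleGraph V) (v : V) : Prop :=
  ENat.card G.ConnectedComponent < ENat.card (G.induce {v}ᶜ).ConnectedComponent

/-- A block of `G` is a maximal connected subgraph that has no cut vertex (of its own). -/
def IsBlock {V : Type*} (G : SimpleGraph V) (B : G.Subgraph) : Prop :=
  Maximal (fun H : G.Subgraph => H.Connected ∧ ∀ v : H.verts, ¬ IsCutVertex H.coe v) B

/-- A block graph: a connected graph in which the vertex set of every block is a clique. -/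
def IsBlockGraph {V : Type*} (G : SimpleGraph V) : Prop :=
  G.Connected ∧ ∀ B : G.Subgraph, IsBlock G B → G.IsClique B.verts

/-! ## Edge-Disjoint Paths -/

/-- An instance of Edge-Disjoint Paths: a finite simple graph on the vertices `0, …, n - 1` and an
ordered multiset (a list) of pairs of distinct vertices. -/
structure Inst where
  /-- number of vertices -/
  n : ℕ
  /-- the graph -/
  graph : SimpleGraph (Fin n)
  /-- the terminal pairs -/
  pairs : List (Fin n × Fin n)
  distinct : ∀ p ∈ pairs, p.1 ≠ p.2

/-- The parameter: the number of (occurrences of) terminal pairs. -/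
def Inst.k (I : Inst) : ℕ := I.pairs.length

/-- Yes-instances: there are pairwise edge-disjoint paths, one for each occurrence of a terminal
pair, that connect the two terminals of the pair. -/
def Inst.IsYes (I : Inst) : Prop :=
  ∃ P : (i : Fin I.pairs.length) → I.graph.Walk (I.pairs.get i).1 (I.pairs.get i).2,
    (∀ i, (P i).IsPath) ∧ ∀ i j, i ≠ j → List.Disjoint (P i).edges (P j).edges

/-! ## The machine model

Programs of a small functional language with `while` loops work on binary trees (the cons cells of
Lisp). The cost of a run counts every operation executed; an operation that copies its argument or a
part of it is charged the size of the argument, so a run of cost `t` never produces a value of size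
greater than `t`. This model and Turing machines simulate each other with polynomial overhead. -/

/-- Binary trees: the data that programs work on. -/
inductive Data : Type
  | nil : Data
  | cons : Data → Data → Data

namespace Data

/-- The number of nodes. -/
def size : Data → ℕ
  | nil => 1
  | cons a b => 1 + a.size + b.size

/-- The first component (of `nil`: `nil`). -/
def fst : Data → Data
  | nil => nil
  | cons a _ => a

/-- The second component (of `nil`: `nil`). -/
def snd : Data → Data
  | nil => nil
  | cons _ b => b

/-- A list of trees as a tree. -/
def ofList : List Data → Data
  | [] => nil
  | a :: l => cons a (ofList l)

/-- Natural numbers in unary. -/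
def ofNat : ℕ → Data
  | 0 => nil
  | m + 1 => cons nil (ofNat m)

open Classical in
/-- Truth values: `nil` is false. -/
noncomputable def ofProp (p : Prop) : Data := if p then cons nil nil else nil

end Data

/-- Programs. Each one maps an input tree to an output tree, if it terminates. -/
inductive Prog : Type
  /-- the constant `nil` -/
  | nil : Prog
  /-- the input itself -/
  | arg : Prog
  /-- first component of the input -/
  | fst : Prog
  /-- second component of the input -/
  | snd : Prog
  /-- run both programs on the input and pair the results -/
  | cons : Prog → Prog → Prog
  /-- run the first program, then the second one on its result -/
  | comp : Prog → Prog → Prog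
  /-- `ite c p q`: if the result of `c` on the input is not `nil` then `p` else `q` -/
  | ite : Prog → Prog → Prog → Prog
  /-- `loop c p`: while the result of `c` on the current value is not `nil`, replace the current
  value by the result of `p` on it -/
  | loop : Prog → Prog → Prog

/-- `Runs p x y t`: on input `x`, the program `p` halts with output `y` after time `t`. -/
inductive Runs : Prog → Data → Data → ℕ → Prop
  | nil (x : Data) : Runs .nil x .nil 1
  | arg (x : Data) : Runs .arg x x x.size
  | fst (x : Data) : Runs .fst x x.fst x.size
  | snd (x : Data) : Runs .snd x x.snd x.size
  | cons {p q : Prog} {x a b : Data} {t u : ℕ} :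
      Runs p x a t → Runs q x b u → Runs (.cons p q) x (.cons a b) (t + u + 1)
  | comp {p q : Prog} {x y z : Data} {t u : ℕ} :
      Runs p x y t → Runs q y z u → Runs (.comp p q) x z (t + u + 1)
  | ite_true {c p q : Prog} {x a b y : Data} {t u : ℕ} :
      Runs c x (.cons a b) t → Runs p x y u → Runs (.ite c p q) x y (t + u + 1)
  | ite_false {c p q : Prog} {x y : Data} {t u : ℕ} :
      Runs c x .nil t → Runs q x y u → Runs (.ite c p q) x y (t + u + 1)
  | loop_stop {c p : Prog} {x : Data} {t : ℕ} :
      Runs c x .nil t → Runs (.loop c p) x x (t + x.size + 1)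
  | loop_step {c p : Prog} {x a b y z : Data} {t u w : ℕ} :
      Runs c x (.cons a b) t → Runs p x y u → Runs (.loop c p) y z w →
        Runs (.loop c p) x z (t + u + w + 1)

/-- The encoding of an instance: the rows of the adjacency matrix and the list of terminal pairs,
with vertices written in unary. Its size is polynomial in the number of vertices and `k`. -/
noncomputable def Inst.encode (I : Inst) : Data :=
  .cons
    (.ofList (List.ofFn fun i : Fin I.n =>
      .ofList (List.ofFn fun j : Fin I.n => .ofProp (I.graph.Adj i j))))
    (.ofList (I.pairs.map fun p => .cons (.ofNat p.1) (.ofNat p.2)))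

/-- `f` is computed by one program, on all instances that satisfy the promise `D`, in time
polynomial in the size of the instance. -/
def PolyTimeOn (D : Inst → Prop) (f : Inst → Inst) : Prop :=
  ∃ (p : Prog) (bound : Polynomial ℕ), ∀ I : Inst, D I →
    ∃ t : ℕ, Runs p I.encode (f I).encode t ∧ t ≤ bound.eval I.encode.size

end EDPKernel

/-! The nontrivial blocks of a block graph are cliques arranged like a tree. Each vertex has a
projection onto each block: the vertex at which a walk from it first meets the block. `BlockDecomp`
records the cliques together with these retractions; `exists_blockDecomp` extracts it from a block
graph, and `BlockDecomp.isBlock_cases` recovers the blocks from it.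

Connections restrict to blocks, and connections inside blocks concatenate, so an instance is
routable exactly if the projected demands are routable in every block (`BlockDecomp.routable_iff`).
A clique with more vertices than nontrivial demands is always routable (`routable_cliqueOn`): delete
one endpoint of a demand, sending every demand at it along its own edge to a different neighbour and
the chosen demand directly to its target. Such blocks can be contracted without changing the answer
(`BlockDecomp.routable_contract_iff`). Every remaining, bad block has at most as many vertices as
demands crossing it, hence at most `k`.

If the terminals have only two projections on a bad block, then all crossing demands meet at one
vertex and outnumber its edges in the block; the answer is No (`Inst.of_refuse`), and a fixed
No-instance with two demands is returned. Otherwise every bad block sees three distinct terminal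
projections. List the `2k` terminals and charge each block to the terminal that supplies its third
projection: no two blocks share a charge and the first two terminals receive none, so at most `2k -
2` blocks remain (`BlockDecomp.card_add_two_le`). Thus the contracted graph has at most `max 1 ((2k
- 2)k)` vertices, which is stronger than required.

For the running time, functions computed by polynomial-time programs are shown to be closed under
list operations and bounded iteration. The algorithm names a block by one of its edges and tests
equality of projections by reachability without the edges of the block, so neither blocks nor
projections are ever constructed. -/

namespace EDPKernel

/-! ## Polynomial-time functions -/

/-- Encodings as trees. -/
class Enc (α : Type) where
  enc : α → Data

open Enc (enc)

instance : Enc Unit := ⟨fun _ => .nil⟩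
instance : Enc Bool := ⟨fun b => cond b (.cons .nil .nil) .nil⟩
instance : Enc ℕ := ⟨Data.ofNat⟩
instance {α β : Type} [Enc α] [Enc β] : Enc (α × β) := ⟨fun p => .cons (enc p.1) (enc p.2)⟩
instance {α : Type} [Enc α] : Enc (List α) := ⟨fun l => .ofList (l.map enc)⟩

/-- The size of the encoding. -/
def esize {α : Type} [Enc α] (a : α) : ℕ := (enc a).size

/-- Functions that some program computes in polynomial time. -/
@[fun_prop]
def PolyTime {α β : Type} [Enc α] [Enc β] (f : α → β) : Prop :=
  ∃ (p : Prog) (b : Polynomial ℕ), ∀ a, ∃ t, Runs p (enc a) (enc (f a)) t ∧ t ≤ b.eval (esize a)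

theorem Data.size_fst_le (d : Data) : d.fst.size ≤ d.size := by
  cases d <;> simp [Data.size, Data.fst]; omega

theorem Data.size_snd_le (d : Data) : d.snd.size ≤ d.size := by
  cases d <;> simp [Data.size, Data.snd]

/-- Turns time bounds into size bounds; composition needs them, because the time of the second
program is bounded in terms of the intermediate value. -/
theorem Runs.size_le {p : Prog} {x y : Data} {t : ℕ} (h : Runs p x y t) : y.size ≤ t := by
  induction h with
  | nil x => simp [Data.size]
  | arg x => exact le_rfl
  | fst x => exact x.size_fst_le
  | snd x => exact x.size_snd_le
  | cons _ _ h1 h2 => simp only [Data.size]; omega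
  | _ => omega

theorem eval_mono_nat (b : Polynomial ℕ) : Monotone fun n => b.eval n := by
  intro m n h
  simp only [Polynomial.eval_eq_sum, Polynomial.sum]
  gcongr

@[simp] theorem enc_pair {α β : Type} [Enc α] [Enc β] (a : α) (b : β) :
    enc (a, b) = .cons (enc a) (enc b) := rfl

@[simp] theorem enc_nil {α : Type} [Enc α] : enc ([] : List α) = .nil := rfl

@[simp] theorem enc_cons {α : Type} [Enc α] (a : α) (l : List α) :
    enc (a :: l) = .cons (enc a) (enc l) := rfl

@[simp] theorem esize_pair {α β : Type} [Enc α] [Enc β] (a : α) (b : β) :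
    esize (a, b) = 1 + esize a + esize b := rfl

@[simp] theorem esize_nil {α : Type} [Enc α] : esize ([] : List α) = 1 := rfl

@[simp] theorem esize_cons {α : Type} [Enc α] (a : α) (l : List α) :
    esize (a :: l) = 1 + esize a + esize l := rfl

theorem enc_nat_eq (n : ℕ) : enc n = enc (List.replicate n ()) := by
  induction n with
  | zero => rfl
  | succ n ih =>
    rw [List.replicate_succ, enc_cons, ← ih]; rfl

namespace PolyTime

variable {α β γ δ σ : Type} [Enc α] [Enc β] [Enc γ] [Enc δ] [Enc σ]

theorem exists_size_le {f : α → β} (hf : PolyTime f) :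
    ∃ b : Polynomial ℕ, ∀ a, esize (f a) ≤ b.eval (esize a) := by
  obtain ⟨p, b, h⟩ := hf
  refine ⟨b, fun a => ?_⟩
  obtain ⟨t, ht, hb⟩ := h a
  exact ht.size_le.trans hb

/-- A function can be replaced by one that acts in the same way on the encodings. -/
theorem of_enc {f : α → β} {g : γ → δ} (hg : PolyTime g) (e : α → γ)
    (he : ∀ a, enc (e a) = enc a) (h : ∀ a, enc (g (e a)) = enc (f a)) : PolyTime f := by
  obtain ⟨p, b, hp⟩ := hg
  refine ⟨p, b, fun a => ?_⟩
  obtain ⟨t, ht, hb⟩ := hp (e a)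
  rw [he, h] at ht
  simp only [esize, he] at hb
  exact ⟨t, ht, hb⟩

@[fun_prop]
theorem id : PolyTime fun a : α => a :=
  ⟨.arg, Polynomial.X, fun a => ⟨_, .arg _, by simp [esize]⟩⟩

@[fun_prop]
theorem comp {g : β → γ} {f : α → β} (hg : PolyTime g) (hf : PolyTime f) :
    PolyTime fun a => g (f a) := by
  obtain ⟨p, b, hp⟩ := hf
  obtain ⟨q, c, hq⟩ := hg
  refine ⟨.comp p q, b + c.comp b + 1, fun a => ?_⟩
  obtain ⟨t, ht, hb⟩ := hp a
  obtain ⟨u, hu, hc⟩ := hq (f a)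
  refine ⟨_, .comp ht hu, ?_⟩
  have : c.eval (esize (f a)) ≤ c.eval (b.eval (esize a)) :=
    eval_mono_nat c (ht.size_le.trans hb)
  simp
  omega

@[fun_prop]
theorem const (b : β) : PolyTime fun _ : α => b := by
  have : ∀ d : Data, ∃ (p : Prog) (t : ℕ), ∀ x, Runs p x d t := by
    intro d
    induction d with
    | nil => exact ⟨.nil, 1, fun x => .nil x⟩
    | cons a b iha ihb =>
      obtain ⟨p, t, hp⟩ := iha
      obtain ⟨q, u, hq⟩ := ihb
      exact ⟨.cons p q, t + u + 1, fun x => .cons (hp x) (hq x)⟩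
  obtain ⟨p, t, hp⟩ := this (enc b)
  exact ⟨p, Polynomial.C t, fun a => ⟨t, hp _, by simp⟩⟩

@[fun_prop]
theorem pair {f : α → β} {g : α → γ} (hf : PolyTime f) (hg : PolyTime g) :
    PolyTime fun a => (f a, g a) := by
  obtain ⟨p, b, hp⟩ := hf
  obtain ⟨q, c, hq⟩ := hg
  refine ⟨.cons p q, b + c + 1, fun a => ?_⟩
  obtain ⟨t, ht, hb⟩ := hp a
  obtain ⟨u, hu, hc⟩ := hq a
  refine ⟨_, .cons ht hu, ?_⟩
  simp
  omega

@[fun_prop]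
theorem fst : PolyTime (Prod.fst : α × β → α) :=
  ⟨.fst, Polynomial.X, fun a => ⟨_, .fst _, by simp [esize]⟩⟩

@[fun_prop]
theorem snd : PolyTime (Prod.snd : α × β → β) :=
  ⟨.snd, Polynomial.X, fun a => ⟨_, .snd _, by simp [esize]⟩⟩

/-- Case distinction by the root of the encoding of a value. -/
theorem case {k : α → β} {f g h : α → γ} (hk : PolyTime k) (hf : PolyTime f) (hg : PolyTime g)
    (h0 : ∀ a, enc (k a) = .nil → h a = g a) (h1 : ∀ a, enc (k a) ≠ .nil → h a = f a) :
    PolyTime h := by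
  obtain ⟨r, d, hr⟩ := hk
  obtain ⟨p, b, hp⟩ := hf
  obtain ⟨q, c, hq⟩ := hg
  refine ⟨.ite r p q, d + b + c + 1, fun a => ?_⟩
  obtain ⟨t, ht, hb⟩ := hp a
  obtain ⟨u, hu, hc⟩ := hq a
  obtain ⟨w, hw, hd⟩ := hr a
  rcases h' : enc (k a) with _ | ⟨x, y⟩
  · refine ⟨_, .ite_false (h' ▸ hw) (h0 a h' ▸ hu), ?_⟩
    simp
    omega
  · refine ⟨_, .ite_true (h' ▸ hw) (h1 a (by simp [h']) ▸ ht), ?_⟩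
    simp
    omega

@[fun_prop]
theorem cond {c : α → Bool} {f g : α → β} (hc : PolyTime c) (hf : PolyTime f) (hg : PolyTime g) :
    PolyTime fun a => bif c a then f a else g a :=
  case hc hf hg (fun a h => by cases h' : c a <;> simp [h', enc] at h ⊢)
    (fun a h => by cases h' : c a <;> simp [h', enc] at h ⊢)

@[fun_prop]
theorem not {c : α → Bool} (hc : PolyTime c) : PolyTime fun a => !c a := by
  have := hc.cond (const false) (const true)
  convert this using 2 with a
  cases c a <;> rfl

@[fun_prop]
theorem and {c d : α → Bool} (hc : PolyTime c) (hd : PolyTime d) :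
    PolyTime fun a => c a && d a := by
  have := hc.cond hd (const false)
  convert this using 2 with a
  cases c a <;> rfl

@[fun_prop]
theorem or {c d : α → Bool} (hc : PolyTime c) (hd : PolyTime d) :
    PolyTime fun a => c a || d a := by
  have := hc.cond (const true) hd
  convert this using 2 with a
  cases c a <;> rfl

@[fun_prop]
theorem list_cons {f : α → β} {l : α → List β} (hf : PolyTime f) (hl : PolyTime l) :
    PolyTime fun a => f a :: l a :=
  (hf.pair hl).of_enc (fun a => a) (fun _ => rfl) (fun _ => rfl)

@[fun_prop]
theorem tail : PolyTime (List.tail : List α → List α) :=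
  ⟨.snd, Polynomial.X, fun l => ⟨(enc l).size, by
    have := Runs.snd (enc l)
    cases l <;> exact this, by simp [esize]⟩⟩

theorem headD (d : α) : PolyTime fun l : List α => l.headD d := by
  obtain ⟨p, b, h⟩ := (const d : PolyTime fun _ : List α => d)
  refine ⟨.ite .arg .fst p, b + 2 * Polynomial.X + 1, fun l => ?_⟩
  rcases l with _ | ⟨a, l⟩
  · obtain ⟨t, ht, hb⟩ := h []
    refine ⟨_, .ite_false (.arg _) ht, ?_⟩
    simp [Data.size] at hb ⊢
    omega
  · refine ⟨_, .ite_true (.arg _) (.fst _), ?_⟩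
    simp [esize, Data.size]
    omega

@[fun_prop]
theorem isEmpty : PolyTime (List.isEmpty : List α → Bool) :=
  case id (const false) (const true) (fun l => by cases l <;> simp)
    (fun l => by cases l <;> simp)

end PolyTime

/-! ### Sizes of encoded lists -/

theorem esize_le_of_mem {α : Type} [Enc α] {l : List α} {a : α} (h : a ∈ l) :
    esize a ≤ esize l := by
  induction h with
  | head l => simp; omega
  | tail b _ ih => simp; omega

theorem length_lt_esize {α : Type} [Enc α] (l : List α) : l.length < esize l := by
  induction l with
  | nil => simp
  | cons a l ih => simp; omega

theorem esize_list_le {α : Type} [Enc α] {l : List α} {m : ℕ} (h : ∀ a ∈ l, esize a ≤ m) :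
    esize l ≤ 1 + l.length * (1 + m) := by
  induction l with
  | nil => simp
  | cons a l ih =>
    have h1 := h a (by simp)
    have h2 := ih fun b hb => h b (by simp [hb])
    simp only [esize_cons, List.length_cons, Nat.add_mul]
    omega

theorem esize_reverse {α : Type} [Enc α] (l : List α) : esize l.reverse = esize l := by
  have key : ∀ l m : List α, esize (l ++ m) + 1 = esize l + esize m := by
    intro l m
    induction l with
    | nil => simp; omega
    | cons a l ih => simp; omega
  induction l with
  | nil => rfl
  | cons a l ih =>
    have := key l.reverse [a]
    simp at this ⊢
    omega

theorem esize_le_of_sublist {α : Type} [Enc α] {l m : List α} (h : l.Sublist m) :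
    esize l ≤ esize m := by
  induction h with
  | slnil => exact le_rfl
  | cons a _ ih => simp; omega
  | cons_cons a _ ih => simp; omega

namespace PolyTime

variable {α β γ δ σ : Type} [Enc α] [Enc β] [Enc γ] [Enc δ] [Enc σ]

/-- Recursion over a list, if the accumulator stays small. -/
theorem foldl [Inhabited α] {step : γ × σ × α → σ} {l : γ → List α} {i : γ → σ}
    (hstep : PolyTime step) (hl : PolyTime l) (hi : PolyTime i) (q : Polynomial ℕ)
    (hq : ∀ c m, m <+: l c → esize (m.foldl (fun s a => step (c, s, a)) (i c)) ≤ q.eval (esize c)) :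
    PolyTime fun c => (l c).foldl (fun s a => step (c, s, a)) (i c) := by
  have hinit : PolyTime fun c => (l c, i c, c) := by fun_prop
  have hhead := headD (default : α)
  have hbody : PolyTime fun x : List α × σ × γ =>
      (x.1.tail, step (x.2.2, x.2.1, x.1.headD default), x.2.2) := by fun_prop
  have hfin : PolyTime fun x : List α × σ × γ => x.2.1 := by fun_prop
  obtain ⟨lb, hlb⟩ := hl.exists_size_le
  obtain ⟨pb, bb, hb⟩ := hbody
  -- Bounds the loop state: remaining list, accumulator and context, plus 2 for the two pairing
  -- nodes.
  let S : Polynomial ℕ := lb + q + Polynomial.X + 2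
  -- There are at most `lb` rounds, each costing the test, the body and 1; the final `2 * S + 1`
  -- pays for the last test and for returning the state.
  have hloop : ∀ c, ∃ t, Runs (.loop .fst pb) (enc (l c, i c, c))
      (enc (([] : List α), (l c).foldl (fun s a => step (c, s, a)) (i c), c)) t ∧
      t ≤ (lb * (S + bb.comp S + 1) + (2 * S + 1)).eval (esize c) := by
    intro c
    have hS : ∀ m₁ m₂, m₁ ++ m₂ = l c →
        esize (m₂, m₁.foldl (fun s a => step (c, s, a)) (i c), c) ≤ S.eval (esize c) := by
      intro m₁ m₂ h
      have h1 := hq c m₁ ⟨m₂, h⟩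
      have h2 : esize m₂ ≤ esize (l c) := esize_le_of_sublist (h ▸ List.sublist_append_right _ _)
      have h3 := hlb c
      simp [S]
      omega
    have main : ∀ m₂ m₁, m₁ ++ m₂ = l c → ∃ t, Runs (.loop .fst pb)
        (enc (m₂, m₁.foldl (fun s a => step (c, s, a)) (i c), c))
        (enc (([] : List α), (l c).foldl (fun s a => step (c, s, a)) (i c), c)) t ∧
        t ≤ m₂.length * ((S + bb.comp S + 1).eval (esize c)) + (2 * S + 1).eval (esize c) := by
      intro m₂
      induction m₂ with
      | nil =>
        intro m₁ h
        have h4 := hS m₁ [] h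
        simp only [List.append_nil] at h
        rw [h] at h4 ⊢
        refine ⟨_, Runs.loop_stop (.fst _), ?_⟩
        have h5 : (Polynomial.eval (esize c) (2 * S)) = 2 * Polynomial.eval (esize c) S := by simp
        rw [List.length_nil, zero_mul, Polynomial.eval_add, Polynomial.eval_one, h5, zero_add]
        change _ + esize _ + 1 ≤ _
        change esize _ + esize _ + 1 ≤ _
        omega
      | cons a m₂ ih =>
        intro m₁ h
        have h4 := hS m₁ (a :: m₂) h
        obtain ⟨t, ht, htb⟩ := ih (m₁ ++ [a]) (by simpa using h)
        obtain ⟨u, hu, hub⟩ := hb (a :: m₂, m₁.foldl (fun s a => step (c, s, a)) (i c), c)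
        simp only [List.foldl_append, List.foldl_cons, List.foldl_nil] at ht
        have hub' := hub.trans (eval_mono_nat bb h4)
        refine ⟨_, .loop_step (.fst _) hu ht, ?_⟩
        change esize _ + u + t + 1 ≤ _
        simp only [List.length_cons, Nat.add_mul, one_mul]
        simp only [Polynomial.eval_add, Polynomial.eval_comp, Polynomial.eval_one] at htb hub' ⊢
        omega
    obtain ⟨t, ht, htb⟩ := main (l c) [] rfl
    refine ⟨t, ht, htb.trans ?_⟩
    have := (length_lt_esize (l c)).le.trans (hlb c)
    rw [Polynomial.eval_add (q := 2 * S + 1), Polynomial.eval_mul]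
    gcongr
  have hmid : ∃ (p : Prog) (b : Polynomial ℕ), ∀ c, ∃ t, Runs p (enc c)
      (enc (([] : List α), (l c).foldl (fun s a => step (c, s, a)) (i c), c)) t ∧
      t ≤ b.eval (esize c) := by
    obtain ⟨p, b, hp⟩ := hinit
    refine ⟨.comp p (.loop .fst pb), b + (lb * (S + bb.comp S + 1) + (2 * S + 1)) + 1, fun c => ?_⟩
    obtain ⟨t, ht, htb⟩ := hp c
    obtain ⟨u, hu, hub⟩ := hloop c
    refine ⟨_, .comp ht hu, ?_⟩
    rw [Polynomial.eval_add, Polynomial.eval_add]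
    simp only [Polynomial.eval_one]
    omega
  exact hfin.comp (f := fun c => (([] : List α), (l c).foldl (fun s a => step (c, s, a)) (i c), c))
    hmid

theorem reverse : PolyTime (List.reverse : List α → List α) := by
  -- `foldl` needs a default element; over an empty type the only list is empty.
  by_cases hα : Nonempty α
  · obtain ⟨a⟩ := hα
    have : Inhabited α := ⟨a⟩
    have : PolyTime fun x : List α × List α × α => x.2.2 :: x.2.1 := by fun_prop
    have key : ∀ m : List α, m.foldl (fun s a => a :: s) [] = m.reverse := by
      intro m
      rw [List.foldl_flip_cons_eq_append', List.append_nil]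
    have := foldl this (id (α := List α)) (const []) Polynomial.X (by
      intro c m hm
      simp only [key, Polynomial.eval_X, esize_reverse]
      exact esize_le_of_sublist hm.sublist)
    simpa only [key] using this
  · have : (List.reverse : List α → List α) = fun l => l := by
      funext l
      cases l with
      | nil => rfl
      | cons a => exact absurd ⟨a⟩ hα
    rw [this]
    exact id

end PolyTime
end EDPKernel

/-! ### Polynomial-time list operations, iteration and arithmetic -/

namespace EDPKernel
open Enc (enc)

namespace PolyTime

variable {α β γ δ σ : Type} [Enc α] [Enc β] [Enc γ] [Enc δ] [Enc σ]

/-- A fold collects the images in reverse order. The accumulator stays small because each element,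
hence each image, is polynomially bounded. -/
theorem map [Inhabited α] {f : γ × α → β} {l : γ → List α} (hf : PolyTime f) (hl : PolyTime l) :
    PolyTime fun c => (l c).map fun a => f (c, a) := by
  have hstep : PolyTime fun x : γ × List β × α => f (x.1, x.2.2) :: x.2.1 := by fun_prop
  have key : ∀ (c : γ) (m : List α),
      m.foldl (fun s a => f (c, a) :: s) [] = (m.map fun a => f (c, a)).reverse := by
    intro c m
    rw [← List.foldl_map (f := fun a => f (c, a)) (g := fun s b => b :: s),
      List.foldl_flip_cons_eq_append', List.append_nil]
  obtain ⟨lb, hlb⟩ := hl.exists_size_le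
  obtain ⟨fb, hfb⟩ := hf.exists_size_le
  have := foldl hstep hl (const []) (1 + lb * (1 + fb.comp (1 + Polynomial.X + lb))) (by
    intro c m hm
    have hm' : esize m ≤ esize (l c) := esize_le_of_sublist hm.sublist
    have h2 := hlb c
    simp only [key, esize_reverse]
    have h1 : ∀ b ∈ m.map (fun a => f (c, a)),
        esize b ≤ fb.eval (1 + esize c + lb.eval (esize c)) := by
      intro b hb
      obtain ⟨a, ha, rfl⟩ := List.mem_map.1 hb
      refine (hfb _).trans (eval_mono_nat fb ?_)
      have := esize_le_of_mem ha
      simp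
      omega
    refine (esize_list_le h1).trans ?_
    rw [List.length_map]
    have := (length_lt_esize m).le.trans (hm'.trans h2)
    simp only [Polynomial.eval_add, Polynomial.eval_one, Polynomial.eval_mul, Polynomial.eval_comp,
      Polynomial.eval_X]
    gcongr)
  simp only [key] at this
  simpa using reverse.comp this

theorem filter [Inhabited α] {f : γ × α → Bool} {l : γ → List α} (hf : PolyTime f)
    (hl : PolyTime l) : PolyTime fun c => (l c).filter fun a => f (c, a) := by
  have hstep : PolyTime fun x : γ × List α × α =>
      bif f (x.1, x.2.2) then x.2.2 :: x.2.1 else x.2.1 := by fun_prop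
  have key : ∀ (c : γ) (m s : List α),
      m.foldl (fun s a => bif f (c, a) then a :: s else s) s =
        (m.filter fun a => f (c, a)).reverse ++ s := by
    intro c m
    induction m with
    | nil => simp
    | cons a m ih =>
      intro s
      rw [List.foldl_cons, ih]
      cases h : f (c, a) <;> simp [h]
  obtain ⟨lb, hlb⟩ := hl.exists_size_le
  have := foldl hstep hl (const []) lb (by
    intro c m hm
    simp only [key, List.append_nil, esize_reverse]
    exact (esize_le_of_sublist (List.filter_sublist.trans hm.sublist)).trans (hlb c))
  simp only [key, List.append_nil] at this
  simpa using reverse.comp this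

theorem any [Inhabited α] {f : γ × α → Bool} {l : γ → List α} (hf : PolyTime f)
    (hl : PolyTime l) : PolyTime fun c => (l c).any fun a => f (c, a) := by
  have := (isEmpty.comp (filter hf hl)).not
  convert this using 2 with c
  rw [Bool.eq_iff_iff]
  simp

theorem append {l m : γ → List α} (hl : PolyTime l) (hm : PolyTime m) :
    PolyTime fun c => l c ++ m c := by
  by_cases hα : Nonempty α
  · obtain ⟨a⟩ := hα
    have : Inhabited α := ⟨a⟩
    have hstep : PolyTime fun x : γ × List α × α => x.2.2 :: x.2.1 := by fun_prop
    have hr : PolyTime fun c => (l c).reverse := reverse.comp hl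
    obtain ⟨lb, hlb⟩ := hr.exists_size_le
    obtain ⟨mb, hmb⟩ := hm.exists_size_le
    have key : ∀ k s : List α, k.foldl (fun s a => a :: s) s = k.reverse ++ s := by
      intro k s
      rw [List.foldl_flip_cons_eq_append']
    have hsize : ∀ k s : List α, esize (k ++ s) ≤ esize k + esize s := by
      intro k s
      induction k with
      | nil => simp
      | cons a k ih => simp; omega
    have := foldl hstep hr hm (lb + mb) (by
      intro c k hk
      simp only [key, Polynomial.eval_add]
      refine (hsize _ _).trans ?_
      rw [esize_reverse]
      exact add_le_add ((esize_le_of_sublist hk.sublist).trans (hlb c)) (hmb c))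
    simpa only [key, List.reverse_reverse] using this
  · convert hl using 2 with c
    cases h : m c with
    | nil => simp
    | cons a => exact absurd ⟨a⟩ hα

/-- Iteration, if the values stay small. -/
theorem iterate {step : γ × σ → σ} {n : γ → ℕ} {i : γ → σ} (hstep : PolyTime step)
    (hn : PolyTime n) (hi : PolyTime i) (q : Polynomial ℕ)
    (hq : ∀ c m, m ≤ n c → esize ((fun s => step (c, s))^[m] (i c)) ≤ q.eval (esize c)) :
    PolyTime fun c => (fun s => step (c, s))^[n c] (i c) := by
  -- A unary number is encoded like a list of units, so iteration is a fold over that list.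
  have hl : PolyTime fun c => List.replicate (n c) () :=
    hn.of_enc (fun c => c) (fun _ => rfl) fun c => enc_nat_eq _
  have hs : PolyTime fun x : γ × σ × Unit => step (x.1, x.2.1) := by fun_prop
  have key : ∀ (c : γ) (m : ℕ) (s : σ), (List.replicate m ()).foldl (fun s _ => step (c, s)) s =
      (fun s => step (c, s))^[m] s := by
    intro c m
    induction m with
    | zero => intro s; rfl
    | succ m ih => intro s; rw [List.replicate_succ, List.foldl_cons, ih, Function.iterate_succ_apply]
  have := foldl hs hl hi q (by
    intro c m hm
    obtain ⟨r, hr⟩ : ∃ r, m = List.replicate r () :=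
      ⟨m.length, List.eq_replicate_iff.2 ⟨rfl, fun _ _ => rfl⟩⟩
    subst hr
    rw [key]
    exact hq c r (by simpa using hm.length_le))
  simpa only [key] using this

@[fun_prop]
theorem length : PolyTime (List.length : List α → ℕ) := by
  by_cases hα : Nonempty α
  · obtain ⟨a⟩ := hα
    have : Inhabited α := ⟨a⟩
    have : PolyTime fun l : List α => l.map fun _ => () :=
      map (f := fun _ => ()) (by fun_prop) id
    refine this.of_enc (fun l => l) (fun _ => rfl) fun l => ?_
    rw [enc_nat_eq, List.map_const']
  · convert (const 0 : PolyTime fun _ : List α => 0) using 2 with l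
    cases l with
    | nil => rfl
    | cons a => exact absurd ⟨a⟩ hα

@[fun_prop]
theorem succ {f : γ → ℕ} (hf : PolyTime f) : PolyTime fun c => f c + 1 :=
  ((const ()).pair hf).of_enc (fun a => a) (fun _ => rfl) (fun _ => rfl)

@[fun_prop]
theorem pred {f : γ → ℕ} (hf : PolyTime f) : PolyTime fun c => f c - 1 := by
  refine comp (g := fun n => n - 1) ?_ hf
  refine (tail (α := Unit)).of_enc (fun n => List.replicate n ()) (fun n => (enc_nat_eq n).symm) ?_
  intro n
  rw [enc_nat_eq, List.tail_replicate]

theorem esize_nat (n : ℕ) : esize n = 2 * n + 1 := by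
  induction n with
  | zero => rfl
  | succ n ih =>
    change Data.size (.cons .nil (enc n)) = _
    change 1 + 1 + esize n = _
    omega

@[fun_prop]
theorem sub {f g : γ → ℕ} (hf : PolyTime f) (hg : PolyTime g) : PolyTime fun c => f c - g c := by
  have hs : PolyTime fun x : γ × ℕ => x.2 - 1 := by fun_prop
  have key : ∀ m n : ℕ, (fun s => s - 1)^[m] n = n - m := by
    intro m
    induction m with
    | zero => intro n; rfl
    | succ m ih => intro n; rw [Function.iterate_succ_apply, ih]; omega
  obtain ⟨b, hb⟩ := hf.exists_size_le
  have := iterate hs hg hf b (by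
    intro c m _
    rw [key]
    refine le_trans ?_ (hb c)
    simp only [esize_nat]
    omega)
  simpa only [key] using this

@[fun_prop]
theorem le {f g : γ → ℕ} (hf : PolyTime f) (hg : PolyTime g) :
    PolyTime fun c => decide (f c ≤ g c) := by
  refine case (hf.sub hg) (const false) (const true) (fun a h => ?_) (fun a h => ?_)
  · simp only [decide_eq_true_eq]
    cases h' : f a - g a with
    | zero => omega
    | succ m => rw [h'] at h; cases h
  · simp only [decide_eq_false_iff_not]
    cases h' : f a - g a with
    | zero => rw [h'] at h; exact absurd rfl h
    | succ m => omega

@[fun_prop]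
theorem eq {f g : γ → ℕ} (hf : PolyTime f) (hg : PolyTime g) :
    PolyTime fun c => f c == g c := by
  convert (hf.le hg).and (hg.le hf) using 2 with c
  rw [Bool.eq_iff_iff]
  simp
  omega

@[fun_prop]
theorem range {f : γ → ℕ} (hf : PolyTime f) : PolyTime fun c => List.range (f c) := by
  have hs : PolyTime fun x : γ × List ℕ => 0 :: x.2.map fun a => a + 1 :=
    list_cons (by fun_prop) (map (f := fun y : (γ × List ℕ) × ℕ => y.2 + 1) (by fun_prop)
      (by fun_prop))
  have key : ∀ m : ℕ, (fun s : List ℕ => 0 :: s.map fun a => a + 1)^[m] [] = List.range m := by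
    intro m
    induction m with
    | zero => rfl
    | succ m ih =>
      rw [Function.iterate_succ_apply', ih, List.range_succ_eq_map]
  obtain ⟨b, hb⟩ := hf.exists_size_le
  have := iterate hs hf (const []) (1 + b * (1 + b)) (by
    intro c m hm
    rw [key]
    have h1 := hb c
    rw [esize_nat] at h1
    refine (esize_list_le (m := b.eval (esize c)) fun a ha => ?_).trans ?_
    · rw [esize_nat]
      have := List.mem_range.1 ha
      omega
    · rw [List.length_range]
      simp only [Polynomial.eval_add, Polynomial.eval_one, Polynomial.eval_mul]
      gcongr
      omega)
  simpa only [key] using this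

theorem getD {l : γ → List α} {i : γ → ℕ} (hl : PolyTime l) (hi : PolyTime i) (d : α) :
    PolyTime fun c => (l c).getD (i c) d := by
  have hs : PolyTime fun x : γ × List α => x.2.tail := by fun_prop
  have key : ∀ (m : ℕ) (l : List α), List.tail^[m] l = l.drop m := by
    intro m
    induction m with
    | zero => intro l; rfl
    | succ m ih =>
      intro l
      rw [Function.iterate_succ_apply, ih, List.drop_tail]
  obtain ⟨b, hb⟩ := hl.exists_size_le
  have := iterate hs hi hl b (by
    intro c m _
    change esize (List.tail^[m] (l c)) ≤ _
    rw [key]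
    exact (esize_le_of_sublist (List.drop_sublist _ _)).trans (hb c))
  convert (headD d).comp this using 2 with c
  change _ = (List.tail^[i c] (l c)).headD d
  rw [key, List.getD_eq_getElem?_getD, List.headD_eq_head?_getD, List.head?_drop]

end PolyTime

/-! ## Reachability -/

/-- One round of breadth-first search on the numbers below `n`. -/
def searchStep (n : ℕ) (e : ℕ → ℕ → Bool) (s : List ℕ) : List ℕ :=
  (List.range n).filter fun w => s.any fun u => u == w || e u w

/-- Reachability in the directed graph `e` on the numbers below `n`. -/
def reaches (n : ℕ) (e : ℕ → ℕ → Bool) (a b : ℕ) : Bool :=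
  ((searchStep n e)^[n] [a]).any fun u => u == b

theorem PolyTime.reaches {γ : Type} [Enc γ] {n a b : γ → ℕ} {e : γ × ℕ × ℕ → Bool}
    (hn : PolyTime n) (he : PolyTime e) (ha : PolyTime a) (hb : PolyTime b) :
    PolyTime fun c => reaches (n c) (fun i j => e (c, i, j)) (a c) (b c) := by
  have hs : PolyTime fun x : γ × List ℕ => searchStep (n x.1) (fun i j => e (x.1, i, j)) x.2 := by
    unfold searchStep
    refine filter (f := fun y : (γ × List ℕ) × ℕ =>
      y.1.2.any fun u => u == y.2 || e (y.1.1, u, y.2)) ?_ (by fun_prop)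
    exact any (f := fun z : ((γ × List ℕ) × ℕ) × ℕ => z.2 == z.1.2 || e (z.1.1.1, z.2, z.1.2))
      (by fun_prop) (by fun_prop)
  have hr : PolyTime fun c => List.range (n c) := by fun_prop
  have ha' : PolyTime fun c => [a c] := by fun_prop
  obtain ⟨rb, hrb⟩ := hr.exists_size_le
  obtain ⟨ab, hab⟩ := ha'.exists_size_le
  have := iterate hs hn ha' (ab + rb) (by
    intro c m _
    rw [Polynomial.eval_add]
    rcases m with _ | m
    · exact (hab c).trans (Nat.le_add_right _ _)
    · rw [Function.iterate_succ_apply']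
      exact ((esize_le_of_sublist List.filter_sublist).trans (hrb c)).trans (Nat.le_add_left _ _))
  exact any (f := fun x : γ × ℕ => x.2 == b x.1) (by fun_prop) this

theorem mem_searchStep {n : ℕ} {e : ℕ → ℕ → Bool} {s : List ℕ} {w : ℕ} :
    w ∈ searchStep n e s ↔ w < n ∧ ∃ u ∈ s, u = w ∨ e u w = true := by
  simp [searchStep]

/-- The search finds exactly the vertices of the connected component. -/
theorem reaches_iff {n : ℕ} {e : ℕ → ℕ → Bool} {G : SimpleGraph (Fin n)}
    (h : ∀ i j : Fin n, e i j = true ↔ G.Adj i j) (a b : Fin n) :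
    reaches n e a b = true ↔ G.Reachable a b := by
  have key : ∀ (m : ℕ) (w : ℕ), w ∈ (searchStep n e)^[m] [(a : ℕ)] ↔
      ∃ (hw : w < n) (p : G.Walk a ⟨w, hw⟩), p.length ≤ m := by
    intro m
    induction m with
    | zero =>
      intro w
      simp only [Function.iterate_zero, id_eq, List.mem_singleton, nonpos_iff_eq_zero]
      constructor
      · rintro rfl
        exact ⟨a.2, .nil, rfl⟩
      · rintro ⟨hw, p, hp⟩
        have := SimpleGraph.Walk.eq_of_length_eq_zero hp
        rw [this]
    | succ m ih =>
      intro w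
      rw [Function.iterate_succ_apply', mem_searchStep]
      constructor
      · rintro ⟨hw, u, hu, h1⟩
        obtain ⟨hu', p, hp⟩ := (ih u).1 hu
        rcases h1 with rfl | h1
        · exact ⟨hw, p, hp.trans (Nat.le_succ m)⟩
        · exact ⟨hw, p.concat ((h ⟨u, hu'⟩ ⟨w, hw⟩).1 h1), by simpa using hp⟩
      · rintro ⟨hw, p, hp⟩
        refine ⟨hw, ?_⟩
        rcases Nat.lt_or_ge p.length (m + 1) with h1 | h1
        · exact ⟨w, (ih w).2 ⟨hw, p, Nat.le_of_lt_succ h1⟩, Or.inl rfl⟩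
        · have hnil : ¬ p.Nil := by
            rw [← SimpleGraph.Walk.length_eq_zero_iff]
            omega
          refine ⟨p.penultimate, (ih _).2 ⟨p.penultimate.2, p.dropLast, ?_⟩, Or.inr ?_⟩
          · have : p.dropLast.length + 1 = p.length := by
              rw [← SimpleGraph.Walk.length_dropLast_add_one hnil]
            omega
          · exact (h _ ⟨w, hw⟩).2 (p.adj_penultimate hnil)
  simp only [reaches, List.any_eq_true, beq_iff_eq, exists_eq_right, key]
  constructor
  · rintro ⟨_, p, _⟩
    exact ⟨p⟩
  · rintro ⟨p⟩
    classical
    -- A path has fewer than `n` edges, so `n` rounds of search suffice.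
    refine ⟨b.2, p.toPath, ?_⟩
    have := p.toPath.2.length_lt
    simp at this
    exact this.le

end EDPKernel

namespace EDPKernel

/-! ## Blocks and projections onto them -/

theorem reachable_induct {V : Type*} {G : SimpleGraph V} {P : V → Prop}
    (h : ∀ u v, G.Adj u v → P u → P v) {a b : V} (hab : G.Reachable a b) (ha : P a) : P b := by
  obtain ⟨p⟩ := hab
  induction p with
  | nil => exact ha
  | cons e _ ih => exact ih (h _ _ e ha)

theorem reachable_of_walk {V X : Type*} {G : SimpleGraph V} {K : SimpleGraph X} {i : X → V}
    (hi : Function.Injective i) (hK : ∀ x y, G.Adj (i x) (i y) → K.Adj x y) {a b : V}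
    (p : G.Walk a b) (hp : ∀ v ∈ p.support, ∃ x, i x = v) :
    ∀ x y, i x = a → i y = b → K.Reachable x y := by
  induction p with
  | nil =>
    rintro x y rfl h
    rw [hi h]
  | @cons u v w e p ih =>
    rintro x y rfl rfl
    obtain ⟨z, rfl⟩ := hp v (by simp)
    exact (hK _ _ e).reachable.trans
      (ih (fun w hw => hp w (by simp [hw])) z y rfl rfl)

theorem not_isCutVertex {V : Type*} {G : SimpleGraph V} {v : V}
    (h : (G.induce {v}ᶜ).Preconnected) : ¬ IsCutVertex G v := by
  have := h.subsingleton_connectedComponent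
  have h1 : 1 ≤ ENat.card G.ConnectedComponent :=
    (ENat.one_le_card_iff_nonempty _).2 ⟨G.connectedComponentMk v⟩
  have h2 := (ENat.card_le_one_iff_subsingleton _).2 this
  exact not_lt.2 (h2.trans h1)

theorem isCutVertex_of_not_reachable {V : Type*} {G : SimpleGraph V} (hG : G.Connected) {v : V}
    {a b : ({v}ᶜ : Set V)} (h : ¬ (G.induce {v}ᶜ).Reachable a b) : IsCutVertex G v := by
  have h1 := (ENat.card_le_one_iff_subsingleton _).2 hG.preconnected.subsingleton_connectedComponent
  refine h1.trans_lt ((ENat.one_lt_card_iff_nontrivial _).2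
    ⟨SimpleGraph.connectedComponentMk _ a, SimpleGraph.connectedComponentMk _ b, fun hab => h ?_⟩)
  exact SimpleGraph.ConnectedComponent.eq.1 hab

/-- Connected subgraphs without cut vertices; the blocks are the maximal ones. -/
def NoCut {V : Type*} {G : SimpleGraph V} (H : G.Subgraph) : Prop :=
  H.Connected ∧ ∀ v : H.verts, ¬ IsCutVertex H.coe v

/-- Taking `F` empty gives connectedness and `F` a singleton excludes a cut vertex, so both
requirements become one. -/
theorem noCut_induce {V : Type*} {G : SimpleGraph V} {S : Set V} (hS : S.Nonempty)
    (h : ∀ F : Set V, F.Subsingleton → ∀ a ∈ S \ F, ∀ b ∈ S \ F,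
      ∃ p : G.Walk a b, ∀ x ∈ p.support, x ∈ S \ F) :
    NoCut ((⊤ : G.Subgraph).induce S) := by
  refine ⟨?_, ?_⟩
  · rw [SimpleGraph.Subgraph.connected_iff]
    refine ⟨⟨fun x y => ?_⟩, hS⟩
    obtain ⟨p, hp⟩ := h ∅ Set.subsingleton_empty x ⟨x.2, by simp⟩ y ⟨y.2, by simp⟩
    refine reachable_of_walk (i := fun z => z.1) Subtype.val_injective ?_ p ?_ x y rfl rfl
    · intro x y hxy
      exact ⟨x.2, y.2, hxy⟩
    · intro v hv
      exact ⟨⟨v, (hp v hv).1⟩, rfl⟩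
  · intro v
    refine not_isCutVertex fun x y => ?_
    have hne : ∀ z : ({v}ᶜ : Set ((⊤ : G.Subgraph).induce S).verts), z.1.1 ∈ S \ {v.1} := by
      intro z
      exact ⟨z.1.2, fun hz => z.2 (Subtype.ext hz)⟩
    obtain ⟨p, hp⟩ := h {v.1} Set.subsingleton_singleton _ (hne x) _ (hne y)
    refine reachable_of_walk (i := fun z => z.1.1)
      (Subtype.val_injective.comp Subtype.val_injective) ?_ p ?_ x y rfl rfl
    · intro x y hxy
      exact ⟨x.1.2, y.1.2, hxy⟩
    · intro w hw
      exact ⟨⟨⟨w, (hp w hw).1⟩, fun hz => (hp w hw).2 (congrArg Subtype.val hz)⟩, rfl⟩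

theorem noCut_induce_of_isClique {V : Type*} {G : SimpleGraph V} {S : Set V} (hS : S.Nonempty)
    (h : G.IsClique S) : NoCut ((⊤ : G.Subgraph).induce S) := by
  refine noCut_induce hS fun F _ a ha b hb => ?_
  by_cases hab : a = b
  · subst hab
    exact ⟨.nil, by simpa using ha⟩
  · refine ⟨(h ha.1 hb.1 hab).toWalk, ?_⟩
    simp only [SimpleGraph.Walk.support_cons, SimpleGraph.Walk.support_nil, List.mem_cons,
      List.not_mem_nil, or_false]
    rintro x (rfl | rfl) <;> assumption

/-- A clique with a path that joins two of its vertices has no cut vertex. -/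
theorem noCut_induce_union {V : Type*} {G : SimpleGraph V} {S : Set V} (h : G.IsClique S)
    {x y : V} (hx : x ∈ S) (hy : y ∈ S) {p : G.Walk x y} (hp : p.IsPath) :
    NoCut ((⊤ : G.Subgraph).induce (S ∪ {v | v ∈ p.support})) := by
  classical
  refine noCut_induce ⟨x, Or.inl hx⟩ fun F hF => ?_
  set T := (S ∪ {v | v ∈ p.support}) \ F
  have clique : ∀ a ∈ S \ F, ∀ b ∈ S \ F, ∃ q : G.Walk a b, ∀ z ∈ q.support, z ∈ T := by
    intro a ha b hb
    by_cases hab : a = b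
    · subst hab
      exact ⟨.nil, by simpa using ⟨Or.inl ha.1, ha.2⟩⟩
    · refine ⟨(h ha.1 hb.1 hab).toWalk, ?_⟩
      simp only [SimpleGraph.Walk.support_cons, SimpleGraph.Walk.support_nil, List.mem_cons,
        List.not_mem_nil, or_false]
      rintro z (rfl | rfl)
      · exact ⟨Or.inl ha.1, ha.2⟩
      · exact ⟨Or.inl hb.1, hb.2⟩
  have toS : ∀ a ∈ T, ∃ c ∈ S \ F, ∃ q : G.Walk a c, ∀ z ∈ q.support, z ∈ T := by
    rintro a ⟨ha | ha, haF⟩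
    · exact ⟨a, ⟨ha, haF⟩, .nil, by simpa using ⟨Or.inl ha, haF⟩⟩
    -- A path meets `F` at most once, so from `a` it can be followed to `y` or back to `x` without
    -- meeting `F`.
    · by_cases hbad : ∃ z ∈ (p.takeUntil a ha).support, z ∈ F
      · obtain ⟨z, hz, hzF⟩ := hbad
        have hgood : ∀ w ∈ (p.dropUntil a ha).support, w ∉ F := by
          intro w hw hwF
          have hzw := hF hwF hzF
          subst hzw
          have hap : ((p.takeUntil a ha).append (p.dropUntil a ha)).IsPath := by
            rwa [p.take_spec]
          have hnd := hap.support_nodup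
          rw [SimpleGraph.Walk.support_append] at hnd
          rw [SimpleGraph.Walk.mem_support_iff] at hw
          rcases hw with rfl | hw
          · exact haF hwF
          · exact (List.disjoint_of_nodup_append hnd) hz hw
        refine ⟨y, ⟨hy, hgood y (by simp)⟩, p.dropUntil a ha, fun z hz => ⟨Or.inr ?_, hgood z hz⟩⟩
        exact p.support_dropUntil_subset_support ha hz
      · push Not at hbad
        refine ⟨x, ⟨hx, hbad x (by simp)⟩, (p.takeUntil a ha).reverse, fun z hz => ?_⟩
        rw [SimpleGraph.Walk.support_reverse, List.mem_reverse] at hz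
        exact ⟨Or.inr (p.support_takeUntil_subset_support ha hz), hbad z hz⟩
  intro a ha b hb
  obtain ⟨c, hc, q, hq⟩ := toS a ha
  obtain ⟨d, hd, r, hr⟩ := toS b hb
  obtain ⟨w, hw⟩ := clique c hc d hd
  refine ⟨(q.append w).append r.reverse, fun z hz => ?_⟩
  rw [SimpleGraph.Walk.mem_support_append_iff, SimpleGraph.Walk.mem_support_append_iff,
    SimpleGraph.Walk.support_reverse, List.mem_reverse] at hz
  rcases hz with (hz | hz) | hz
  exacts [hq z hz, hw z hz, hr z hz]

/-- A decomposition of a connected graph into cliques `C b`, each with a retraction onto it that is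
constant on the other cliques. -/
structure BlockDecomp {V : Type*} (G : SimpleGraph V) (ι : Type*) where
  C : ι → Set V
  proj : ι → V → V
  proj_mem : ∀ b x, proj b x ∈ C b
  proj_self : ∀ b x, x ∈ C b → proj b x = x
  adj_iff : ∀ u v, G.Adj u v ↔ u ≠ v ∧ ∃ b, u ∈ C b ∧ v ∈ C b
  proj_eq : ∀ b b' u v, b ≠ b' → u ∈ C b → v ∈ C b → proj b' u = proj b' v
  nontrivial : ∀ b, (C b).Nontrivial
  connected : G.Connected

/-- The graph without the edges inside `S`. -/
def away {V : Type*} (G : SimpleGraph V) (S : Set V) : SimpleGraph V where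
  Adj u v := G.Adj u v ∧ ¬ (u ∈ S ∧ v ∈ S)
  symm := ⟨fun _ _ h => ⟨h.1.symm, fun h' => h.2 h'.symm⟩⟩
  loopless := ⟨fun _ h => h.1.ne rfl⟩

theorem away_le {V : Type*} (G : SimpleGraph V) (S : Set V) : away G S ≤ G := fun _ _ h => h.1

/-- Every vertex of a connected graph reaches `S` without an edge inside `S`. -/
theorem exists_reachable_away {V : Type*} {G : SimpleGraph V} (hG : G.Connected) {S : Set V}
    (hS : S.Nonempty) (x : V) : ∃ c ∈ S, (away G S).Reachable x c := by
  obtain ⟨s, hs⟩ := hS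
  refine reachable_induct (P := fun x => ∃ c ∈ S, (away G S).Reachable x c) ?_
    (hG.preconnected s x) ⟨s, hs, .rfl⟩
  rintro u v huv ⟨c, hc, hr⟩
  by_cases h : v ∈ S
  · exact ⟨v, h, .rfl⟩
  · refine ⟨c, hc, .trans (SimpleGraph.Adj.reachable ?_) hr⟩
    exact ⟨huv.symm, fun h' => h h'.1⟩

/-- A path outside the block's edges joining two of its vertices could be added to the block without
creating a cut vertex. By maximality it already lies in the block, yet its first edge does not. -/
theorem eq_of_reachable_away {V : Type*} {G : SimpleGraph V} {H : G.Subgraph} (hH : IsBlock G H)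
    (hc : G.IsClique H.verts) {x y : V} (hx : x ∈ H.verts) (hy : y ∈ H.verts)
    (h : (away G H.verts).Reachable x y) : x = y := by
  classical
  by_contra hxy
  obtain ⟨p, hp⟩ := h.exists_isPath
  have hq : (p.mapLe (away_le G H.verts)).IsPath := hp.mapLe _
  have hmax := hH.2 (noCut_induce_union hc hx hy hq) (by
    refine ⟨fun v hv => Or.inl hv, fun u v huv => ?_⟩
    exact ⟨Or.inl (H.edge_vert huv), Or.inl (H.edge_vert huv.symm), H.adj_sub huv⟩)
  cases p with
  | nil => exact hxy rfl
  | @cons _ v _ e p =>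
    exact e.2 ⟨hx, hmax.1 (Or.inr (by simp))⟩

/-- The projection of `x` onto a block is the only vertex of the block that `x` reaches without the
block's edges. One-vertex blocks are left out: they carry no edges. -/
theorem exists_blockDecomp {V : Type*} [Finite V] {G : SimpleGraph V} (hG : IsBlockGraph G) :
    ∃ p : Set V → Prop, Nonempty (BlockDecomp G {S // p S}) := by
  classical
  let Bl : Set V → Prop := fun S => S.Nontrivial ∧ ∃ H : G.Subgraph, IsBlock G H ∧ H.verts = S
  have hcl : ∀ S, Bl S → G.IsClique S := by
    rintro _ ⟨_, H, hH, rfl⟩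
    exact hG.2 H hH
  have heq : ∀ S, Bl S → ∀ x ∈ S, ∀ y ∈ S, (away G S).Reachable x y → x = y := by
    rintro _ ⟨_, H, hH, rfl⟩ x hx y hy h
    exact eq_of_reachable_away hH (hG.2 H hH) hx hy h
  have hex : ∀ S : {S // Bl S}, ∀ x, ∃ c ∈ S.1, (away G S.1).Reachable x c :=
    fun S x => exists_reachable_away hG.1 S.2.1.nonempty x
  choose proj hproj hreach using hex
  -- If two blocks share `u` and `v`, a vertex `w` of `S` outside `S'` would give a detour `u`, `w`,
  -- `v` around the edges of `S'`.
  have hsub : ∀ S S', Bl S → Bl S' → ∀ u ∈ S, u ∈ S' → ∀ v ∈ S, v ∈ S' → u ≠ v → S ⊆ S' := by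
    intro S S' hS hS' u hu hu' v hv hv' huv w hw
    by_contra hw'
    refine huv (heq S' hS' u hu' v hv' ?_)
    have h1 : (away G S').Adj u w :=
      ⟨hcl S hS hu hw fun h => hw' (h ▸ hu'), fun h => hw' h.2⟩
    have h2 : (away G S').Adj w v :=
      ⟨hcl S hS hw hv fun h => hw' (h ▸ hv'), fun h => hw' h.1⟩
    exact h1.reachable.trans h2.reachable
  refine ⟨Bl, ⟨⟨fun S => S.1, proj, hproj, ?_, ?_, ?_, fun S => S.2.1,
    hG.1⟩⟩⟩
  · intro S x hx
    exact (heq S.1 S.2 x hx _ (hproj S x) (hreach S x)).symm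
  · intro u v
    constructor
    · intro huv
      refine ⟨huv.ne, ?_⟩
      -- An edge is a clique, so by finiteness it extends to a maximal connected subgraph without
      -- cut vertex.
      obtain ⟨H, hle, hH⟩ := Finite.exists_le_maximal (noCut_induce_of_isClique (G := G)
        (S := {u, v}) ⟨u, by simp⟩ (by
          rw [SimpleGraph.isClique_pair]
          exact fun _ => huv))
      have hu : u ∈ H.verts := hle.1 (show u ∈ ({u, v} : Set V) by simp)
      have hv : v ∈ H.verts := hle.1 (show v ∈ ({u, v} : Set V) by simp)
      exact ⟨⟨H.verts, ⟨u, hu, v, hv, huv.ne⟩, H, hH, rfl⟩, hu, hv⟩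
    · rintro ⟨hne, S, hu, hv⟩
      exact hcl S.1 S.2 hu hv hne
  · intro S S' u v hne hu hv
    by_cases huv : u = v
    · rw [huv]
    have hr : (away G S'.1).Reachable u v := by
      by_cases hin : u ∈ S'.1 ∧ v ∈ S'.1
      · refine absurd (Subtype.ext (Set.Subset.antisymm ?_ ?_)) hne
        · exact hsub _ _ S.2 S'.2 u hu hin.1 v hv hin.2 huv
        · exact hsub _ _ S'.2 S.2 u hin.1 hu v hin.2 hv huv
      · exact SimpleGraph.Adj.reachable ⟨hcl S.1 S.2 hu hv huv, hin⟩
    exact heq S'.1 S'.2 _ (hproj _ _) _ (hproj _ _)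
      (((hreach S' u).symm.trans hr).trans (hreach S' v))

namespace BlockDecomp

variable {V ι : Type*} {G : SimpleGraph V} (D : BlockDecomp G ι)
include D

theorem isClique (b : ι) : G.IsClique (D.C b) :=
  fun _ hu _ hv hne => (D.adj_iff _ _).2 ⟨hne, b, hu, hv⟩

/-- The local rule behind the reachability arguments: only edges inside a block move the projection
onto it. -/
theorem proj_adj (b : ι) {u v : V} (h : G.Adj u v) :
    D.proj b u = D.proj b v ∨ u ∈ D.C b ∧ v ∈ D.C b := by
  obtain ⟨_, b', hu, hv⟩ := (D.adj_iff u v).1 h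
  by_cases hb : b' = b
  · subst hb
    exact Or.inr ⟨hu, hv⟩
  · exact Or.inl (D.proj_eq b' b u v hb hu hv)

theorem block_unique {b b' : ι} {u v : V} (huv : u ≠ v) (hu : u ∈ D.C b) (hv : v ∈ D.C b)
    (hu' : u ∈ D.C b') (hv' : v ∈ D.C b') : b = b' := by
  by_contra hb
  have := D.proj_eq b b' u v hb hu hv
  rw [D.proj_self _ _ hu', D.proj_self _ _ hv'] at this
  exact huv this

/-- Of two blocks, each lies behind one vertex of the other. -/
theorem exists_gates {b b' : ι} (hb : b ≠ b') :
    ∃ g g', ∀ t, D.proj b t = g ∨ D.proj b' t = g' := by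
  obtain ⟨x, hx⟩ := (D.nontrivial b).nonempty
  obtain ⟨x', hx'⟩ := (D.nontrivial b').nonempty
  -- The gate of each block is the projection of the other block onto it. An edge inside one block
  -- puts its ends behind the gate of the other.
  refine ⟨D.proj b x', D.proj b' x, fun t => ?_⟩
  refine reachable_induct (P := fun t => D.proj b t = D.proj b x' ∨ D.proj b' t = D.proj b' x) ?_
    (D.connected.preconnected x' t) (Or.inl rfl)
  intro u v huv hu
  rcases D.proj_adj b huv with h | h
  · rcases D.proj_adj b' huv with h' | h'
    · rwa [h, h'] at hu
    · exact Or.inl (D.proj_eq b' b v x' hb.symm h'.2 hx')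
  · exact Or.inr (D.proj_eq b b' v x hb h.2 hx)

/-- A vertex outside the block adjacent to both `u` and `v` would project to both. Hence any edge
serves as a name for its block. -/
theorem mem_iff_adj {b : ι} {u v : V} (huv : u ≠ v) (hu : u ∈ D.C b) (hv : v ∈ D.C b) (w : V) :
    w ∈ D.C b ↔ (w = u ∨ G.Adj w u) ∧ (w = v ∨ G.Adj w v) := by
  constructor
  · intro hw
    exact ⟨or_iff_not_imp_left.2 (D.isClique b hw hu), or_iff_not_imp_left.2 (D.isClique b hw hv)⟩
  · rintro ⟨rfl | h1, rfl | h2⟩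
    · exact hu
    · exact hu
    · exact hv
    · rcases D.proj_adj b h1 with h | h
      · rcases D.proj_adj b h2 with h' | h'
        · rw [h, D.proj_self _ _ hu, D.proj_self _ _ hv] at h'
          exact absurd h' huv
        · exact h'.1
      · exact h.1

/-- Edges outside the block preserve the projection, and every vertex reaches its own projection by
such edges. The algorithm compares projections with this test. -/
theorem reachable_away_iff (b : ι) (s t : V) :
    (away G (D.C b)).Reachable s t ↔ D.proj b s = D.proj b t := by
  have key : ∀ s t, (away G (D.C b)).Reachable s t → D.proj b s = D.proj b t := by
    intro s t h
    refine reachable_induct (P := fun t => D.proj b s = D.proj b t) ?_ h rfl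
    intro u v huv hu
    rcases D.proj_adj b huv.1 with h' | h'
    · rwa [← h']
    · exact absurd h' huv.2
  have hr : ∀ s, (away G (D.C b)).Reachable s (D.proj b s) := by
    intro s
    obtain ⟨c, hc, h⟩ := exists_reachable_away D.connected (D.nontrivial b).nonempty s
    rwa [key s c h, D.proj_self b c hc]
  refine ⟨key s t, fun h => ?_⟩
  have := hr s
  rw [h] at this
  exact this.trans (hr t).symm

/-- Everything in `H` outside the clique can reach it only through its projection, which would then
be a cut vertex of `H`. -/
theorem verts_subset_of_noCut {H : G.Subgraph} (hH : NoCut H) {b : ι} {u v : V} (huv : u ≠ v)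
    (hu : u ∈ D.C b) (hv : v ∈ D.C b) (huH : u ∈ H.verts) (hvH : v ∈ H.verts) :
    H.verts ⊆ D.C b := by
  intro w hw
  by_contra hwb
  obtain ⟨z, hz, hzH, hne⟩ : ∃ z ∈ D.C b, z ∈ H.verts ∧ z ≠ D.proj b w := by
    by_cases h : u = D.proj b w
    · exact ⟨v, hv, hvH, fun h' => huv (h.trans h'.symm)⟩
    · exact ⟨u, hu, huH, h⟩
  have hxH : D.proj b w ∈ H.verts := by
    by_contra hx
    have := reachable_induct (P := fun y : H.verts => D.proj b y = D.proj b w) (G := H.coe)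
      (fun y y' h hy => by
        rcases D.proj_adj b (H.adj_sub h) with h' | h'
        · rwa [← h']
        · rw [D.proj_self b _ h'.1] at hy
          exact absurd (hy ▸ y.2) hx) (hH.1.preconnected ⟨w, hw⟩ ⟨z, hzH⟩) rfl
    rw [D.proj_self b _ hz] at this
    exact hne this
  refine hH.2 ⟨_, hxH⟩ (isCutVertex_of_not_reachable hH.1
    (a := ⟨⟨w, hw⟩, fun h => hwb ?_⟩) (b := ⟨⟨z, hzH⟩, fun h => hne (congrArg Subtype.val h)⟩)
    fun hr => ?_)
  · rw [show w = D.proj b w from congrArg Subtype.val h]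
    exact D.proj_mem b w
  · have := reachable_induct (P := fun y => D.proj b y.1.1 = D.proj b w)
      (fun y y' h hy => by
        rcases D.proj_adj b (u := y.1.1) (v := y'.1.1) (H.adj_sub h) with h' | h'
        · rwa [← h']
        · rw [D.proj_self b _ h'.1] at hy
          exact absurd (Subtype.ext hy) y.2) hr rfl
    rw [D.proj_self b _ hz] at this
    exact hne this

/-- The second alternative is the one-vertex graph, whose only block is not among the nontrivial
cliques. This also explains the `max 1` in the counting bounds. -/
theorem isBlock_cases {H : G.Subgraph} (hH : IsBlock G H) :
    (∃ b, H = (⊤ : G.Subgraph).induce (D.C b)) ∨ IsEmpty ι ∧ H.verts.Subsingleton := by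
  have key : ∀ b, H.verts ⊆ D.C b → H = (⊤ : G.Subgraph).induce (D.C b) := by
    intro b hb
    have hle : H ≤ (⊤ : G.Subgraph).induce (D.C b) :=
      ⟨hb, fun u v huv => ⟨hb (H.edge_vert huv), hb (H.edge_vert huv.symm), H.adj_sub huv⟩⟩
    exact le_antisymm hle
      (hH.2 (noCut_induce_of_isClique (D.nontrivial b).nonempty (D.isClique b)) hle)
  by_cases hs : H.verts.Subsingleton
  · by_cases hι : IsEmpty ι
    · exact Or.inr ⟨hι, hs⟩
    · left
      obtain ⟨b⟩ := not_isEmpty_iff.1 hι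
      obtain ⟨x, _, y, _, hxy⟩ := D.nontrivial b
      obtain ⟨z, hz⟩ := hH.1.1.nonempty
      have : Nontrivial V := ⟨x, y, hxy⟩
      obtain ⟨w, hw⟩ := D.connected.preconnected.exists_adj_of_nontrivial z
      obtain ⟨_, b', hz', _⟩ := (D.adj_iff _ _).1 hw
      exact ⟨b', key b' fun v hv => hs hz hv ▸ hz'⟩
  · left
    rw [Set.not_subsingleton_iff] at hs
    obtain ⟨x, hx, y, hy, hxy⟩ := hs
    have : Nontrivial H.verts := ⟨⟨x, hx⟩, ⟨y, hy⟩, fun h => hxy (congrArg Subtype.val h)⟩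
    obtain ⟨z, hz⟩ := hH.1.1.preconnected.exists_adj_of_nontrivial ⟨x, hx⟩
    have hadj : G.Adj x z := H.adj_sub hz
    obtain ⟨hne, b, hb, hb'⟩ := (D.adj_iff _ _).1 hadj
    exact ⟨b, key b (D.verts_subset_of_noCut hH.1 hne hb hb' hx (H.edge_vert hz.symm))⟩

theorem isBlockGraph : IsBlockGraph G := by
  refine ⟨D.connected, fun H hH => ?_⟩
  rcases D.isBlock_cases hH with ⟨b, rfl⟩ | ⟨_, h⟩
  · exact D.isClique b
  · exact fun u hu v hv hne => absurd (h hu hv) hne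

theorem subsingleton_of_isEmpty [IsEmpty ι] : Subsingleton V := by
  by_contra h
  rw [not_subsingleton_iff_nontrivial] at h
  obtain ⟨x⟩ := D.connected.nonempty
  obtain ⟨y, hy⟩ := D.connected.preconnected.exists_adj_of_nontrivial x
  exact isEmptyElim ((D.adj_iff _ _).1 hy).2.choose

theorem ncard_blocks_le [Finite ι] :
    {B : G.Subgraph | IsBlock G B}.ncard ≤ max 1 (Nat.card ι) := by
  by_cases hι : IsEmpty ι
  · have := D.subsingleton_of_isEmpty
    have htop : ∀ K : G.Subgraph, IsBlock G K → K = ⊤ := by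
      intro K hK
      obtain ⟨x, hx⟩ := hK.1.1.nonempty
      refine SimpleGraph.Subgraph.ext (Set.eq_univ_of_forall fun y => Subsingleton.elim x y ▸ hx) ?_
      funext u v
      rw [Subsingleton.elim u v]
      exact propext ⟨fun h => K.adj_sub h, fun h => absurd rfl (G.ne_of_adj h)⟩
    have hsub : {B : G.Subgraph | IsBlock G B} ⊆ {⊤} := fun K hK => htop K hK
    exact le_max_of_le_left ((Set.ncard_le_ncard hsub).trans (Set.ncard_singleton _).le)
  · refine le_max_of_le_right ?_
    have hsub : {B : G.Subgraph | IsBlock G B} ⊆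
        Set.range fun b => (⊤ : G.Subgraph).induce (D.C b) := by
      intro H hH
      rcases D.isBlock_cases hH with ⟨b, rfl⟩ | ⟨h, _⟩
      · exact ⟨b, rfl⟩
      · exact absurd h hι
    refine (Set.ncard_le_ncard hsub (Set.finite_range _)).trans ?_
    rw [← Set.image_univ, ← Set.ncard_univ]
    exact Set.ncard_image_le

end BlockDecomp
end EDPKernel

namespace EDPKernel

/-! ## Routing -/

/-- Pairwise edge-disjoint connections, given by pairwise edge-disjoint subgraphs. -/
def Routable {V κ : Type*} (G : SimpleGraph V) (s t : κ → V) : Prop :=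
  ∃ H : κ → SimpleGraph V, (∀ i, H i ≤ G) ∧
    (∀ i j, i ≠ j → ∀ u v, (H i).Adj u v → ¬ (H j).Adj u v) ∧ ∀ i, (H i).Reachable (s i) (t i)

/-- Subgraphs can be restricted, mapped and united without maintaining paths; a path inside each
connecting subgraph recovers the original formulation. -/
theorem Inst.isYes_iff_routable (I : Inst) :
    I.IsYes ↔ Routable I.graph (fun i => (I.pairs.get i).1) (fun i => (I.pairs.get i).2) := by
  classical
  constructor
  · rintro ⟨P, -, hd⟩
    refine ⟨fun i => SimpleGraph.fromEdgeSet {e | e ∈ (P i).edges}, fun i u v h => ?_,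
      fun i j hij u v h h' => ?_, fun i => ?_⟩
    · exact (P i).adj_of_mem_edges ((SimpleGraph.fromEdgeSet_adj _).1 h).1
    · exact hd i j hij ((SimpleGraph.fromEdgeSet_adj _).1 h).1
        ((SimpleGraph.fromEdgeSet_adj _).1 h').1
    · refine ⟨(P i).transfer _ fun e he => ?_⟩
      rw [SimpleGraph.edgeSet_fromEdgeSet]
      exact ⟨he, I.graph.not_isDiag_of_mem_edgeSet ((P i).edges_subset_edgeSet he)⟩
  · rintro ⟨H, hle, hd, hr⟩
    choose p hp using fun i => (hr i).exists_isPath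
    refine ⟨fun i => (p i).mapLe (hle i), fun i => (hp i).mapLe _, fun i j hij e he he' => ?_⟩
    rw [SimpleGraph.Walk.edges_mapLe_eq_edges] at he he'
    induction e with
    | _ u v => exact hd i j hij u v ((p i).adj_of_mem_edges he) ((p j).adj_of_mem_edges he')

/-- The complete graph on a set of vertices. -/
def cliqueOn {V : Type*} (S : Set V) : SimpleGraph V where
  Adj u v := u ≠ v ∧ u ∈ S ∧ v ∈ S
  symm := ⟨fun _ _ h => ⟨h.1.symm, h.2.2, h.2.1⟩⟩
  loopless := ⟨fun _ h => h.1 rfl⟩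

theorem Routable.map {V W κ : Type*} {S : Set V} {s t : κ → V} (h : Routable (cliqueOn S) s t)
    {f : V → W} (hf : S.InjOn f) : Routable (cliqueOn (f '' S)) (fun i => f (s i))
      (fun i => f (t i)) := by
  obtain ⟨H, hle, hd, hr⟩ := h
  refine ⟨fun i => ⟨fun a b => ∃ x y, (H i).Adj x y ∧ f x = a ∧ f y = b, ⟨?_⟩, ⟨?_⟩⟩, ?_, ?_, ?_⟩
  · rintro _ _ ⟨x, y, h, rfl, rfl⟩
    exact ⟨y, x, h.symm, rfl, rfl⟩
  · rintro _ ⟨x, y, h, rfl, h'⟩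
    obtain ⟨hne, hx, hy⟩ := hle i h
    exact hne (hf hx hy h'.symm)
  · rintro i _ _ ⟨x, y, h, rfl, rfl⟩
    obtain ⟨hne, hx, hy⟩ := hle i h
    exact ⟨fun h' => hne (hf hx hy h'), ⟨x, hx, rfl⟩, ⟨y, hy, rfl⟩⟩
  · rintro i j hij _ _ ⟨x, y, h, rfl, rfl⟩ ⟨x', y', h', hx', hy'⟩
    obtain ⟨-, h1, h2⟩ := hle i h
    obtain ⟨-, h3, h4⟩ := hle j h'
    rw [hf h3 h1 hx', hf h4 h2 hy'] at h'
    exact hd i j hij _ _ h h'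
  · intro i
    refine reachable_induct (P := fun y => SimpleGraph.Reachable _ (f (s i)) (f y)) ?_ (hr i) .rfl
    intro u v huv hu
    exact hu.trans (SimpleGraph.Adj.reachable ⟨u, v, huv, rfl, rfl⟩)

theorem routable_image_iff {V W κ : Type*} {S : Set V} (hS : S.Nonempty) {s t : κ → V}
    (hs : ∀ i, s i ∈ S) (ht : ∀ i, t i ∈ S) {f : V → W} (hf : S.InjOn f) :
    Routable (cliqueOn (f '' S)) (fun i => f (s i)) (fun i => f (t i)) ↔
      Routable (cliqueOn S) s t := by
  refine ⟨fun h => ?_, fun h => h.map hf⟩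
  obtain ⟨x, _⟩ := hS
  have : Nonempty V := ⟨x⟩
  have hinv := hf.leftInvOn_invFunOn
  have hg : (f '' S).InjOn (Function.invFunOn f S) := by
    rintro _ ⟨x, hx, rfl⟩ _ ⟨y, hy, rfl⟩ h
    rw [hinv hx, hinv hy] at h
    rw [h]
  have := h.map hg
  rw [hinv.image_image] at this
  simpa only [hinv (hs _), hinv (ht _)] using this

/-- In a clique, fewer demands than vertices can always be routed. -/
theorem routable_cliqueOn {V κ : Type*} [DecidableEq V] [Fintype κ] (S : Finset V) (s t : κ → V)
    (hs : ∀ i, s i ∈ S) (ht : ∀ i, t i ∈ S)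
    (h : (Finset.univ.filter fun i => s i ≠ t i).card < S.card) :
    Routable (cliqueOn (S : Set V)) s t := by
  classical
  induction hn : S.card generalizing S s t with
  | zero => omega
  | succ n ih =>
    by_cases htriv : ∀ i, s i = t i
    · exact ⟨fun _ => ⊥, fun _ => bot_le, fun _ _ _ _ _ h => absurd h (by simp), fun i => by
        rw [htriv i]⟩
    push Not at htriv
    obtain ⟨i₀, hi₀⟩ := htriv
    set v := s i₀ with hv
    set a := t i₀ with ha
    have hvS : v ∈ S := hs i₀
    have haS : a ∈ S.erase v := Finset.mem_erase.2 ⟨hi₀.symm, ht i₀⟩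
    set D := Finset.univ.filter fun i => s i ≠ t i ∧ (s i = v ∨ t i = v) with hD
    have hmemD : ∀ i, i ∈ D ↔ s i ≠ t i ∧ (s i = v ∨ t i = v) := by simp [hD]
    have hi₀D : i₀ ∈ D := (hmemD _).2 ⟨hi₀, Or.inl rfl⟩
    have hSe : (S.erase v).card = n := by rw [Finset.card_erase_of_mem hvS]; omega
    have hDc : D.card ≤ (S.erase v).card := by
      have : D.card ≤ (Finset.univ.filter fun i => s i ≠ t i).card :=
        Finset.card_le_card fun i hi => by
          simpa using ((hmemD i).1 hi).1
      omega
    -- The demands at `v` get distinct neighbours `z i`; a transposition makes `i₀` go to its target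
    -- `a`.
    obtain ⟨z, hzm, hzi, hz0⟩ : ∃ z : κ → V, (∀ i, z i ∈ S.erase v) ∧ Set.InjOn z D ∧
        z i₀ = a := by
      obtain ⟨f⟩ := Function.Embedding.nonempty_of_card_le (α := D) (β := S.erase v)
        (by simpa using hDc)
      let g : κ → S.erase v := fun i => if h : i ∈ D then f ⟨i, h⟩ else ⟨a, haS⟩
      have hg : ∀ i (h : i ∈ D), g i = f ⟨i, h⟩ := fun i h => dif_pos h
      refine ⟨fun i => (Equiv.swap (g i₀) ⟨a, haS⟩ (g i)).1, fun i => Subtype.prop _, ?_, by simp⟩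
      intro i hi j hj hij
      have := (Equiv.swap (g i₀) ⟨a, haS⟩).injective (Subtype.ext hij)
      rw [hg i hi, hg j hj] at this
      exact congrArg Subtype.val (f.injective this)
    -- A demand outside `D` with an end at `v` is trivial; sending both its ends to `a` keeps it
    -- trivial.
    have hmove : ∀ x ∈ S, ∀ i, (if x = v then (if i ∈ D then z i else a) else x) ∈ S.erase v := by
      intro x hx i
      split_ifs with h1
      · exact hzm i
      · exact haS
      · exact Finset.mem_erase.2 ⟨h1, hx⟩
    obtain ⟨H, hle, hd, hr⟩ := ih (S.erase v)
      (fun i => if s i = v then (if i ∈ D then z i else a) else s i)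
      (fun i => if t i = v then (if i ∈ D then z i else a) else t i)
      (fun i => hmove _ (hs i) i) (fun i => hmove _ (ht i) i) (by
        have hlt : (Finset.univ.filter fun i => (if s i = v then (if i ∈ D then z i else a) else s i)
            ≠ (if t i = v then (if i ∈ D then z i else a) else t i)).card <
            (Finset.univ.filter fun i => s i ≠ t i).card := by
          -- Trivial demands stay trivial and `i₀` becomes trivial, so the count drops along with
          -- the number of vertices.
          refine Finset.card_lt_card (Finset.ssubset_iff_of_subset ?_ |>.2 ⟨i₀, ?_, ?_⟩)
          · intro i
            simp only [Finset.mem_filter, Finset.mem_univ, true_and]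
            intro h h'
            rw [h'] at h
            exact h rfl
          · simpa using hi₀
          · simp [← hv, ← ha, hi₀D, hz0]
        omega) hSe
    have hHv : ∀ i x y, (H i).Adj x y → x ≠ v ∧ y ≠ v := by
      intro i x y hxy
      obtain ⟨_, hx, hy⟩ := hle i hxy
      exact ⟨(Finset.mem_erase.1 hx).1, (Finset.mem_erase.1 hy).1⟩
    refine ⟨fun i => H i ⊔ if i ∈ D then SimpleGraph.edge v (z i) else ⊥, ?_, ?_, ?_⟩
    · intro i x y hxy
      rcases hxy with hxy | hxy
      · obtain ⟨hne, hx, hy⟩ := hle i hxy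
        exact ⟨hne, Finset.mem_of_mem_erase hx, Finset.mem_of_mem_erase hy⟩
      · split_ifs at hxy with hi
        · rw [SimpleGraph.edge_adj] at hxy
          have := Finset.mem_of_mem_erase (hzm i)
          refine ⟨hxy.2, ?_⟩
          rcases hxy.1 with ⟨rfl, rfl⟩ | ⟨rfl, rfl⟩
          · exact ⟨hvS, this⟩
          · exact ⟨this, hvS⟩
        · exact absurd hxy (by simp)
    · have hex : ∀ i x y, (if i ∈ D then SimpleGraph.edge v (z i) else ⊥ : SimpleGraph V).Adj x y →
          i ∈ D ∧ (x = v ∧ y = z i ∨ x = z i ∧ y = v) := by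
        intro i x y hxy
        split_ifs at hxy with hi
        · rw [SimpleGraph.edge_adj] at hxy
          refine ⟨hi, ?_⟩
          rcases hxy.1 with h | h
          · exact Or.inl ⟨h.1, h.2⟩
          · exact Or.inr ⟨h.1, h.2⟩
        · exact absurd hxy (by simp)
      have hzv : ∀ i, z i ≠ v := fun i => (Finset.mem_erase.1 (hzm i)).1
      rintro i j hij x y (h1 | h1) (h2 | h2)
      · exact hd i j hij x y h1 h2
      · rcases (hex j x y h2).2 with ⟨h, _⟩ | ⟨_, h⟩
        · exact (hHv i x y h1).1 h
        · exact (hHv i x y h1).2 h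
      · rcases (hex i x y h1).2 with ⟨h, _⟩ | ⟨_, h⟩
        · exact (hHv j x y h2).1 h
        · exact (hHv j x y h2).2 h
      · obtain ⟨hi, h1⟩ := hex i x y h1
        obtain ⟨hj, h2⟩ := hex j x y h2
        refine hij (hzi hi hj ?_)
        rcases h1 with ⟨rfl, rfl⟩ | ⟨rfl, rfl⟩ <;> rcases h2 with ⟨h3, h4⟩ | ⟨h3, h4⟩
        · exact h4
        · exact absurd h4 (hzv i)
        · exact absurd h3 (hzv i)
        · exact h3
    · intro i
      have h1 := (hr i).mono (le_sup_left (b := if i ∈ D then SimpleGraph.edge v (z i) else ⊥))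
      dsimp only at h1 ⊢
      by_cases hi : i ∈ D
      · have hadj : (H i ⊔ if i ∈ D then SimpleGraph.edge v (z i) else ⊥).Adj v (z i) := by
          right
          rw [if_pos hi, SimpleGraph.edge_adj]
          exact ⟨Or.inl ⟨rfl, rfl⟩, (Finset.mem_erase.1 (hzm i)).1.symm⟩
        have hzi : (if i ∈ D then z i else a) = z i := if_pos hi
        obtain ⟨hne, h2 | h2⟩ := (hmemD i).1 hi
        · have h3 : t i ≠ v := fun h => hne (h2.trans h.symm)
          rw [if_pos h2, hzi, if_neg h3] at h1
          rw [h2]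
          exact hadj.reachable.trans h1
        · have h3 : s i ≠ v := fun h => hne (h.trans h2.symm)
          rw [if_neg h3, if_pos h2, hzi] at h1
          rw [h2]
          exact h1.trans hadj.symm.reachable
      · by_cases hst : s i = t i
        · rw [hst]
        · have h2 : s i ≠ v := fun h => hi ((hmemD i).2 ⟨hst, Or.inl h⟩)
          have h3 : t i ≠ v := fun h => hi ((hmemD i).2 ⟨hst, Or.inr h⟩)
          rwa [if_neg h2, if_neg h3] at h1

/-- At most `|S| - 1` demands at one vertex can be routed in the clique on `S`. -/
theorem Routable.card_lt {V κ : Type*} [DecidableEq V] {S : Finset V} {s t : κ → V}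
    (h : Routable (cliqueOn (S : Set V)) s t) {x : V} (hx : x ∈ S) {A : Finset κ}
    (hA : ∀ i ∈ A, s i ≠ t i ∧ (s i = x ∨ t i = x)) : A.card < S.card := by
  obtain ⟨H, hle, hd, hr⟩ := h
  have hadj : ∀ i ∈ A, ∃ z, (H i).Adj x z := by
    have key : ∀ {K : SimpleGraph V} {y}, K.Reachable x y → x ≠ y → ∃ z, K.Adj x z := by
      rintro K y ⟨p⟩ hxy
      cases p with
      | nil => exact absurd rfl hxy
      | cons e p => exact ⟨_, e⟩
    intro i hi
    obtain ⟨hne, rfl | rfl⟩ := hA i hi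
    · exact key (hr i) hne
    · exact key (hr i).symm hne.symm
  have : Nonempty V := ⟨x⟩
  choose! z hz using hadj
  refine lt_of_le_of_lt (Finset.card_le_card_of_injOn (t := S.erase x) z ?_ ?_)
    (Finset.card_erase_lt_of_mem hx)
  · intro i hi
    obtain ⟨hne, _, h⟩ := hle i (hz i hi)
    exact Finset.mem_erase.2 ⟨hne.symm, h⟩
  · intro i hi j hj hij
    by_contra hne
    exact hd i j hne _ _ (hz i hi) (hij ▸ hz j hj)

/-! ### Routing block by block -/

namespace BlockDecomp

variable {V ι : Type*} {G : SimpleGraph V} (D : BlockDecomp G ι)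

include D in
theorem cliqueOn_le (b : ι) : cliqueOn (D.C b) ≤ G :=
  fun _ _ h => D.isClique b h.2.1 h.2.2 h.1

/-- Take the block of the first edge of a path from `s` to `t`. The rest of the path avoids `s`, so
its projection onto this block never returns to `s`. -/
theorem exists_separating {s t : V} (hst : s ≠ t) : ∃ b, s ∈ D.C b ∧ D.proj b t ≠ s := by
  classical
  obtain ⟨p, hp⟩ := (D.connected.preconnected s t).exists_isPath
  cases p with
  | nil => exact absurd rfl hst
  | @cons _ x _ e p =>
    obtain ⟨hne, b, hs, hx⟩ := (D.adj_iff _ _).1 e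
    refine ⟨b, hs, ?_⟩
    rw [SimpleGraph.Walk.cons_isPath_iff] at hp
    have key : ∀ {x y : V} (q : G.Walk x y), s ∉ q.support → D.proj b x ≠ s → D.proj b y ≠ s := by
      intro x y q
      induction q with
      | nil => exact fun _ h => h
      | @cons u v w e q ih =>
        intro hq hu
        rw [SimpleGraph.Walk.support_cons, List.mem_cons, not_or] at hq
        refine ih hq.2 ?_
        rcases D.proj_adj b e with h | h
        · rwa [← h]
        · rw [D.proj_self b _ h.2]
          rintro rfl
          exact hq.2 q.start_mem_support
    exact key p hp.2 (by rw [D.proj_self b _ hx]; exact hne.symm)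

/-- Connections inside the blocks combine to a connection. -/
theorem reachable_iSup [Finite ι] {H : ι → SimpleGraph V} {s t : V}
    (h : ∀ b, (H b).Reachable (D.proj b s) (D.proj b t)) : (⨆ b, H b).Reachable s t := by
  -- Induction on the number of blocks that separate `s` from `t`: moving from `s` to `D.proj b t`
  -- settles `b` and leaves all other projections unchanged.
  induction hn : {b | D.proj b s ≠ D.proj b t}.ncard using Nat.strong_induction_on
    generalizing s with
  | _ n ih =>
    by_cases hst : s = t
    · rw [hst]
    obtain ⟨b, hs, hb⟩ := D.exists_separating hst
    have h1 := h b
    rw [D.proj_self b s hs] at h1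
    have heq : ∀ b', b' ≠ b → D.proj b' (D.proj b t) = D.proj b' s :=
      fun b' hb' => D.proj_eq b b' _ _ hb'.symm (D.proj_mem b t) hs
    have hself : D.proj b (D.proj b t) = D.proj b t := D.proj_self b _ (D.proj_mem b t)
    refine (h1.mono (le_iSup H b)).trans (ih _ ?_ (fun b' => ?_) rfl)
    · rw [← hn]
      refine Set.ncard_lt_ncard ((Set.ssubset_iff_of_subset ?_).2 ⟨b, ?_, ?_⟩)
      · intro b' hb'
        by_cases hbb : b' = b
        · subst hbb
          exact absurd hself hb'
        · simpa only [Set.mem_ofPred_eq, heq b' hbb] using hb'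
      · rw [Set.mem_ofPred_eq, D.proj_self b s hs]
        exact hb.symm
      · exact fun h' => h' hself
    · by_cases hbb : b' = b
      · subst hbb
        rw [hself]
      · rw [heq b' hbb]
        exact h b'

/-- Routing is possible if and only if it is possible in every block. -/
theorem routable_iff [Finite ι] {κ : Type*} (s t : κ → V) : Routable G s t ↔
    ∀ b, Routable (cliqueOn (D.C b)) (fun i => D.proj b (s i)) (fun i => D.proj b (t i)) := by
  constructor
  · rintro ⟨H, hle, hd, hr⟩ b
    -- Projecting a connection onto the block retains just its edges inside the block.
    refine ⟨fun i => H i ⊓ cliqueOn (D.C b), fun i => inf_le_right,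
      fun i j hij u v h h' => hd i j hij u v h.1 h'.1, fun i => ?_⟩
    refine reachable_induct
      (P := fun y => SimpleGraph.Reachable _ (D.proj b (s i)) (D.proj b y)) ?_ (hr i) .rfl
    intro u v huv hu
    rcases D.proj_adj b (hle i huv) with h | h
    · rwa [← h]
    · rw [D.proj_self b _ h.1] at hu
      rw [D.proj_self b _ h.2]
      exact hu.trans (SimpleGraph.Adj.reachable ⟨huv, huv.ne, h⟩)
  · intro h
    choose H hle hd hr using h
    refine ⟨fun i => ⨆ b, H b i, fun i => iSup_le fun b => (hle b i).trans (D.cliqueOn_le b), ?_,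
      fun i => D.reachable_iSup fun b => hr b i⟩
    intro i j hij u v h h'
    rw [SimpleGraph.iSup_adj] at h h'
    obtain ⟨b, hb⟩ := h
    obtain ⟨b', hb'⟩ := h'
    obtain ⟨hne, hu, hv⟩ := hle b i hb
    obtain ⟨_, hu', hv'⟩ := hle b' j hb'
    have := D.block_unique hne hu hv hu' hv'
    subst this
    exact hd b i j hij u v hb hb'

/-! ## Contraction -/

variable {W : Type*} {G' : SimpleGraph W} {bad : ι → Prop} {Q : V → W}

/-- Each class of `Q` is held together by edges of contracted blocks, and these do not move the
projection onto a bad block. -/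
theorem proj_eq_of_contract (hQ : ∀ x y, Q x = Q y → SimpleGraph.Reachable
      (⨆ b : {b // ¬ bad b}, cliqueOn (D.C b.1)) x y)
    {b : ι} (hb : bad b) {x y : V} (h : Q x = Q y) : D.proj b x = D.proj b y := by
  refine reachable_induct (P := fun y => D.proj b x = D.proj b y) ?_ (hQ x y h) rfl
  intro u v huv hu
  rw [SimpleGraph.iSup_adj] at huv
  obtain ⟨b', _, hu', hv'⟩ := huv
  rw [hu]
  exact D.proj_eq b'.1 b u v (fun h => b'.2 (h ▸ hb)) hu' hv'

theorem injOn_of_contract (hQ : ∀ x y, Q x = Q y → SimpleGraph.Reachable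
      (⨆ b : {b // ¬ bad b}, cliqueOn (D.C b.1)) x y)
    {b : ι} (hb : bad b) : (D.C b).InjOn Q := by
  intro x hx y hy h
  have := D.proj_eq_of_contract hQ hb h
  rwa [D.proj_self b x hx, D.proj_self b y hy] at this

/-- Contraction of the blocks that are not bad. -/
noncomputable def contract (hsurj : Function.Surjective Q)
    (hQ : ∀ x y, Q x = Q y ↔ SimpleGraph.Reachable
      (⨆ b : {b // ¬ bad b}, cliqueOn (D.C b.1)) x y)
    (hG' : ∀ a b, G'.Adj a b ↔ a ≠ b ∧ ∃ x y, Q x = a ∧ Q y = b ∧ G.Adj x y) :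
    BlockDecomp G' {b // bad b} where
  C b := Q '' D.C b.1
  -- The choice of representative is immaterial by `proj_eq_of_contract`.
  proj b a := Q (D.proj b.1 (Function.surjInv hsurj a))
  proj_mem b a := ⟨_, D.proj_mem _ _, rfl⟩
  proj_self := by
    rintro b _ ⟨x, hx, rfl⟩
    rw [D.proj_eq_of_contract (fun x y => (hQ x y).1) b.2 (Function.surjInv_eq hsurj (Q x)),
      D.proj_self _ _ hx]
  adj_iff := by
    intro u v
    rw [hG']
    refine and_congr_right fun hne => ⟨?_, ?_⟩
    · rintro ⟨x, y, rfl, rfl, h⟩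
      obtain ⟨hxy, b, hx, hy⟩ := (D.adj_iff _ _).1 h
      by_cases hb : bad b
      · exact ⟨⟨b, hb⟩, ⟨x, hx, rfl⟩, ⟨y, hy, rfl⟩⟩
      · refine absurd ((hQ x y).2 (SimpleGraph.Adj.reachable ?_)) hne
        rw [SimpleGraph.iSup_adj]
        exact ⟨⟨b, hb⟩, hxy, hx, hy⟩
    · rintro ⟨b, ⟨x, hx, rfl⟩, ⟨y, hy, rfl⟩⟩
      exact ⟨x, y, rfl, rfl, D.isClique b.1 hx hy fun h => hne (congrArg Q h)⟩
  proj_eq := by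
    rintro b b' _ _ hne ⟨x, hx, rfl⟩ ⟨y, hy, rfl⟩
    rw [D.proj_eq_of_contract (fun x y => (hQ x y).1) b'.2 (Function.surjInv_eq hsurj (Q x)),
      D.proj_eq_of_contract (fun x y => (hQ x y).1) b'.2 (Function.surjInv_eq hsurj (Q y)),
      D.proj_eq b.1 b'.1 x y (fun h => hne (Subtype.ext h)) hx hy]
  nontrivial b := (D.nontrivial b.1).image_of_injOn
    (D.injOn_of_contract (fun x y => (hQ x y).1) b.2)
  connected := by
    obtain ⟨x₀⟩ := D.connected.nonempty
    refine { preconnected := fun a b => ?_, nonempty := ⟨Q x₀⟩ }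
    obtain ⟨x, rfl⟩ := hsurj a
    obtain ⟨y, rfl⟩ := hsurj b
    refine reachable_induct (P := fun y => G'.Reachable (Q x) (Q y)) ?_
      (D.connected.preconnected x y) .rfl
    intro u v huv hu
    by_cases h : Q u = Q v
    · rwa [← h]
    · exact hu.trans (SimpleGraph.Adj.reachable ((hG' _ _).2 ⟨h, u, v, rfl, rfl, huv⟩))

theorem contract_proj (hsurj : Function.Surjective Q)
    (hQ : ∀ x y, Q x = Q y ↔ SimpleGraph.Reachable
      (⨆ b : {b // ¬ bad b}, cliqueOn (D.C b.1)) x y)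
    (hG' : ∀ a b, G'.Adj a b ↔ a ≠ b ∧ ∃ x y, Q x = a ∧ Q y = b ∧ G.Adj x y)
    (b : {b // bad b}) (x : V) : (D.contract hsurj hQ hG').proj b (Q x) = Q (D.proj b.1 x) :=
  congrArg Q (D.proj_eq_of_contract (fun x y => (hQ x y).1) b.2 (Function.surjInv_eq hsurj (Q x)))

/-- Contraction of routable blocks does not change the answer. -/
theorem routable_contract_iff [Finite ι] (hsurj : Function.Surjective Q)
    (hQ : ∀ x y, Q x = Q y ↔ SimpleGraph.Reachable
      (⨆ b : {b // ¬ bad b}, cliqueOn (D.C b.1)) x y)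
    (hG' : ∀ a b, G'.Adj a b ↔ a ≠ b ∧ ∃ x y, Q x = a ∧ Q y = b ∧ G.Adj x y)
    {κ : Type*} {s t : κ → V} (hgood : ∀ b, ¬ bad b →
      Routable (cliqueOn (D.C b)) (fun i => D.proj b (s i)) (fun i => D.proj b (t i))) :
    Routable G' (fun i => Q (s i)) (fun i => Q (t i)) ↔ Routable G s t := by
  rw [(D.contract hsurj hQ hG').routable_iff, D.routable_iff]
  simp only [D.contract_proj hsurj hQ hG']
  have hiff : ∀ b : {b // bad b}, _ := fun b => routable_image_iff (D.nontrivial b.1).nonempty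
    (s := fun i => D.proj b.1 (s i)) (t := fun i => D.proj b.1 (t i))
    (fun i => D.proj_mem _ _) (fun i => D.proj_mem _ _)
    (D.injOn_of_contract (fun x y => (hQ x y).1) b.2)
  constructor
  · intro h b
    by_cases hb : bad b
    · exact (hiff ⟨b, hb⟩).1 (h ⟨b, hb⟩)
    · exact hgood b hb
  · exact fun h b => (hiff b).2 (h b.1)

/-! ## Counting blocks -/

/-- In a connected graph with more than one vertex every vertex has an edge, hence lies in a clique
of the decomposition. -/
theorem card_le_max [Finite V] [Finite ι] {k : ℕ} (hk : ∀ b, (D.C b).ncard ≤ k) :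
    Nat.card V ≤ max 1 (Nat.card ι * k) := by
  classical
  by_cases hV : Subsingleton V
  · exact le_max_of_le_left (Finite.card_le_one_iff_subsingleton.2 hV)
  · rw [not_subsingleton_iff_nontrivial] at hV
    refine le_max_of_le_right ?_
    have := Fintype.ofFinite ι
    have := Fintype.ofFinite V
    have hun : (Finset.univ : Finset V) ⊆ Finset.univ.biUnion fun b => (D.C b).toFinset := by
      intro v _
      obtain ⟨w, hw⟩ := D.connected.preconnected.exists_adj_of_nontrivial v
      obtain ⟨_, b, hb, _⟩ := (D.adj_iff _ _).1 hw
      exact Finset.mem_biUnion.2 ⟨b, Finset.mem_univ b, Set.mem_toFinset.2 hb⟩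
    rw [Nat.card_eq_fintype_card, Nat.card_eq_fintype_card, ← Finset.card_univ,
      ← Finset.card_univ]
    refine (Finset.card_le_card hun).trans (Finset.card_biUnion_le_card_mul _ _ _ fun b _ => ?_)
    rw [← Set.ncard_eq_toFinset_card']
    exact hk b

/-- There are few blocks to which some terminals have three different projections. -/
theorem card_add_two_le [Finite ι] [DecidableEq V] (T : ℕ → V) (m : ℕ)
    (h : ∀ b, 3 ≤ ((Finset.range m).image fun i => D.proj b (T i)).card) :
    Nat.card ι ≤ m - 2 := by
  classical
  have hex : ∀ b, ∃ n, 3 ≤ ((Finset.range n).image fun i => D.proj b (T i)).card :=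
    fun b => ⟨m, h b⟩
  -- The shortest prefix of terminals with three projections has length `n + 1`; its last terminal,
  -- with index `n`, supplies the third.
  have hfirst : ∀ b, ∃ n, 2 ≤ n ∧ n < m ∧ (∀ l < n, D.proj b (T l) ≠ D.proj b (T n)) ∧
      2 ≤ ((Finset.range n).image fun i => D.proj b (T i)).card := by
    intro b
    have h3 := Nat.find_spec (hex b)
    have hm : Nat.find (hex b) ≤ m := Nat.find_min' (hex b) (h b)
    obtain ⟨n, hn⟩ : ∃ n, Nat.find (hex b) = n + 1 := by
      refine Nat.exists_eq_succ_of_ne_zero fun h0 => ?_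
      rw [h0] at h3
      simp at h3
    have hmin : ¬ 3 ≤ ((Finset.range n).image fun i => D.proj b (T i)).card :=
      Nat.find_min (hex b) (by omega)
    rw [hn, Finset.range_add_one, Finset.image_insert] at h3
    have hnot : D.proj b (T n) ∉ (Finset.range n).image fun i => D.proj b (T i) := by
      intro hmem
      rw [Finset.insert_eq_of_mem hmem] at h3
      exact hmin h3
    rw [Finset.card_insert_of_notMem hnot] at h3
    have hc := Finset.card_image_le (s := Finset.range n) (f := fun i => D.proj b (T i))
    rw [Finset.card_range] at hc
    refine ⟨n, by omega, by omega, fun l hl heq => hnot ?_, by omega⟩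
    exact Finset.mem_image.2 ⟨l, Finset.mem_range.2 hl, heq⟩
  choose f hf2 hfm hnew hcard using hfirst
  -- If the new projection on `b` is the gate, all earlier terminals miss that gate and so share one
  -- projection on `b'`, although two had already appeared there.
  have aux : ∀ b b' g', f b = f b' →
      ¬ (∀ t, D.proj b t = D.proj b (T (f b)) ∨ D.proj b' t = g') := by
    intro b b' g' hbb hg
    have hsub : ((Finset.range (f b')).image fun i => D.proj b' (T i)) ⊆ {g'} := by
      intro x hx
      obtain ⟨l, hl, rfl⟩ := Finset.mem_image.1 hx
      rw [Finset.mem_range] at hl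
      rcases hg (T l) with h | h
      · exact absurd h (hnew b l (by omega))
      · simpa using h
    have := Finset.card_le_card hsub
    have := hcard b'
    simp at *
    omega
  -- Charges lie in `[2, m)`, whence the shift by 2.
  have hinj : Function.Injective fun b => (⟨f b - 2, by have := hf2 b; have := hfm b; omega⟩ :
      Fin (m - 2)) := by
    intro b b' hbb
    have hbb : f b = f b' := by
      have := hf2 b
      have := hf2 b'
      simp at hbb
      omega
    by_contra hne
    obtain ⟨g, g', hg⟩ := D.exists_gates hne
    rcases hg (T (f b)) with h | h
    · exact aux b b' g' hbb fun t => h ▸ hg t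
    · refine aux b' b g hbb.symm fun t => ?_
      rw [← hbb, h]
      exact (hg t).symm
  simpa using Nat.card_le_card_of_injective _ hinj

end BlockDecomp
end EDPKernel

namespace EDPKernel
open Enc (enc)

/-! ## Dropping trivial demands -/

/-- Routing, one demand after the other. -/
def RoutableList {V : Type*} : SimpleGraph V → List (V × V) → Prop
  | _, [] => True
  | G, p :: L => ∃ H ≤ G, H.Reachable p.1 p.2 ∧ RoutableList (G \ H) L

theorem routableList_map_iff {V α : Type*} (f g : α → V) (L : List α) (G : SimpleGraph V) :
    RoutableList G (L.map fun a => (f a, g a)) ↔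
      Routable G (fun i => f (L.get i)) (fun i => g (L.get i)) := by
  induction L generalizing G with
  | nil =>
    exact ⟨fun _ => ⟨fun _ => ⊥, fun i => i.elim0, fun i => i.elim0, fun i => i.elim0⟩,
      fun _ => trivial⟩
  | cons a L ih =>
    simp only [List.map_cons, RoutableList, ih]
    constructor
    · rintro ⟨H, hle, hr, K, hKle, hKd, hKr⟩
      refine ⟨Fin.cons H K, Fin.cases hle fun i => (hKle i).trans sdiff_le, ?_, Fin.cases hr hKr⟩
      refine Fin.cases (Fin.cases (fun h => absurd rfl h) fun j _ u v h h' => ?_) fun i =>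
        Fin.cases (fun _ u v h h' => ?_) fun j hij => ?_
      · exact (hKle j h').2 h
      · exact (hKle i h).2 h'
      · exact hKd i j fun h => hij (congrArg Fin.succ h)
    · rintro ⟨H, hle, hd, hr⟩
      refine ⟨H 0, hle 0, hr 0, fun i => H i.succ, fun i u v h => ⟨hle _ h, fun h' => ?_⟩,
        fun i j hij => hd _ _ fun h => hij (Fin.succ_injective _ h), fun i => hr i.succ⟩
      exact hd 0 i.succ (Fin.succ_ne_zero i).symm u v h' h

theorem RoutableList.mono {V : Type*} {G G' : SimpleGraph V} {L : List (V × V)}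
    (h : RoutableList G L) (hle : G ≤ G') : RoutableList G' L := by
  induction L generalizing G G' with
  | nil => trivial
  | cons p L ih =>
    obtain ⟨H, hH, hr, h⟩ := h
    exact ⟨H, hH.trans hle, hr, ih h (sdiff_le_sdiff_right hle)⟩

/-- A trivial demand needs no edges, and edges reserved for it may be returned to the others.
Recursion on the list avoids reindexing the demands. -/
theorem routableList_filter_iff {V : Type*} [DecidableEq V] (L : List (V × V))
    (G : SimpleGraph V) :
    RoutableList G (L.filter fun p => p.1 ≠ p.2) ↔ RoutableList G L := by
  induction L generalizing G with
  | nil => rfl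
  | cons p L ih =>
    by_cases hp : p.1 = p.2
    · rw [List.filter_cons_of_neg (by simpa using hp), ih]
      constructor
      · exact fun h => ⟨⊥, bot_le, hp ▸ .rfl, by rwa [sdiff_bot]⟩
      · rintro ⟨H, _, _, h⟩
        exact h.mono sdiff_le
    · rw [List.filter_cons_of_pos (by simpa using hp)]
      simp only [RoutableList, ih]

/-! ## The algorithm -/

/-- Instances as lists. -/
abbrev Raw := List (List Bool) × List (ℕ × ℕ)

namespace Raw

/-- The number of vertices. -/
def order (R : Raw) : ℕ := R.1.length

/-- Adjacency. -/
def adj (R : Raw) (i j : ℕ) : Bool := (R.1.getD i []).getD j false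

/-- Membership in the block of the edge `xy`. -/
def inBlock (R : Raw) (x y w : ℕ) : Bool := (w == x || R.adj w x) && (w == y || R.adj w y)

/-- Connection without edges of the block of `xy`. -/
def joined (R : Raw) (x y a b : ℕ) : Bool :=
  reaches R.order (fun i j => R.adj i j && !(R.inBlock x y i && R.inBlock x y j)) a b

/-- The number of demands that need an edge of the block of `xy`. -/
def demand (R : Raw) (x y : ℕ) : ℕ := (R.2.filter fun p => !R.joined x y p.1 p.2).length

/-- The number of vertices of the block of `xy`. -/
def blockSize (R : Raw) (x y : ℕ) : ℕ :=
  ((List.range R.order).filter fun w => R.inBlock x y w).length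

/-- The edge `xy` lies in a block that has more vertices than demands. -/
def good (R : Raw) (x y : ℕ) : Bool := R.adj x y && decide (R.demand x y + 1 ≤ R.blockSize x y)

/-- The terminals. -/
def terminals (R : Raw) : List ℕ := (R.2.map fun p => p.1) ++ R.2.map fun p => p.2

/-- Three terminals have different projections on the block of `xy`. -/
def spread (R : Raw) (x y : ℕ) : Bool :=
  R.terminals.any fun a => R.terminals.any fun b => R.terminals.any fun c =>
    !R.joined x y a b && (!R.joined x y a c && !R.joined x y b c)

/-- Some block has too many demands between the same two vertices. -/
def refuse (R : Raw) : Bool :=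
  (List.range R.order).any fun x => (List.range R.order).any fun y =>
    R.adj x y && (decide (R.blockSize x y ≤ R.demand x y) && !R.spread x y)

/-- The first vertex that good edges join to `x`. -/
def leader (R : Raw) (x : ℕ) : ℕ :=
  ((List.range R.order).filter fun y => reaches R.order (fun i j => R.good i j) x y).headD 0

/-- The vertices that represent their class. -/
def leaders (R : Raw) : List ℕ := (List.range R.order).filter fun x => R.leader x == x

/-- The vertex of the contracted graph that corresponds to `x`. -/
def cls (R : Raw) (x : ℕ) : ℕ :=
  ((List.range R.leaders.length).filter fun j => R.leaders.getD j 0 == R.leader x).headD 0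

/-- Adjacency in the contracted graph. -/
def contractAdj (R : Raw) (a b : ℕ) : Bool :=
  !(a == b) && (List.range R.order).any fun x => R.cls x == a &&
    (List.range R.order).any fun y => R.cls y == b && R.adj x y

/-- The instance after the contraction of all good edges. -/
def contract (R : Raw) : Raw :=
  ((List.range R.leaders.length).map fun a =>
    (List.range R.leaders.length).map fun b => R.contractAdj a b,
   (R.2.map fun p => (R.cls p.1, R.cls p.2)).filter fun p => !(p.1 == p.2))

/-- The kernelization. -/
def kernel (R : Raw) : Raw :=
  bif R.refuse then ([[false, true], [true, false]], [(0, 1), (0, 1)]) else R.contract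

end Raw

/-! ### Running time of the kernelization -/

namespace PolyTime

theorem order : PolyTime Raw.order := by
  unfold Raw.order
  fun_prop

variable {γ : Type} [Enc γ] {R : γ → Raw} {x y w a b : γ → ℕ}

@[fun_prop]
theorem order' (hR : PolyTime R) : PolyTime fun c => (R c).order := order.comp hR

@[fun_prop]
theorem adj (hR : PolyTime R) (hx : PolyTime x) (hy : PolyTime y) :
    PolyTime fun c => (R c).adj (x c) (y c) := by
  unfold Raw.adj
  exact getD (getD (by fun_prop) hx []) hy false

@[fun_prop]
theorem inBlock (hR : PolyTime R) (hx : PolyTime x) (hy : PolyTime y) (hw : PolyTime w) :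
    PolyTime fun c => (R c).inBlock (x c) (y c) (w c) := by
  unfold Raw.inBlock
  fun_prop

@[fun_prop]
theorem joined (hR : PolyTime R) (hx : PolyTime x) (hy : PolyTime y) (ha : PolyTime a)
    (hb : PolyTime b) : PolyTime fun c => (R c).joined (x c) (y c) (a c) (b c) := by
  unfold Raw.joined
  exact reaches (e := fun z : γ × ℕ × ℕ => (R z.1).adj z.2.1 z.2.2 &&
    !((R z.1).inBlock (x z.1) (y z.1) z.2.1 && (R z.1).inBlock (x z.1) (y z.1) z.2.2))
    (by fun_prop) (by fun_prop) ha hb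

@[fun_prop]
theorem demand (hR : PolyTime R) (hx : PolyTime x) (hy : PolyTime y) :
    PolyTime fun c => (R c).demand (x c) (y c) := by
  unfold Raw.demand
  exact length.comp (filter (f := fun z : γ × ℕ × ℕ =>
    !(R z.1).joined (x z.1) (y z.1) z.2.1 z.2.2) (by fun_prop) (by fun_prop))

@[fun_prop]
theorem blockSize (hR : PolyTime R) (hx : PolyTime x) (hy : PolyTime y) :
    PolyTime fun c => (R c).blockSize (x c) (y c) := by
  unfold Raw.blockSize
  exact length.comp (filter (f := fun z : γ × ℕ => (R z.1).inBlock (x z.1) (y z.1) z.2)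
    (by fun_prop) (by fun_prop))

@[fun_prop]
theorem good (hR : PolyTime R) (hx : PolyTime x) (hy : PolyTime y) :
    PolyTime fun c => (R c).good (x c) (y c) := by
  unfold Raw.good
  fun_prop

@[fun_prop]
theorem terminals (hR : PolyTime R) : PolyTime fun c => (R c).terminals := by
  unfold Raw.terminals
  exact append (map (f := fun z : γ × ℕ × ℕ => z.2.1) (by fun_prop) (by fun_prop))
    (map (f := fun z : γ × ℕ × ℕ => z.2.2) (by fun_prop) (by fun_prop))

@[fun_prop]
theorem spread (hR : PolyTime R) (hx : PolyTime x) (hy : PolyTime y) :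
    PolyTime fun c => (R c).spread (x c) (y c) := by
  unfold Raw.spread
  refine any (f := fun z : γ × ℕ => (R z.1).terminals.any fun b => (R z.1).terminals.any fun c =>
    !(R z.1).joined (x z.1) (y z.1) z.2 b && (!(R z.1).joined (x z.1) (y z.1) z.2 c &&
      !(R z.1).joined (x z.1) (y z.1) b c)) ?_ (by fun_prop)
  refine any (f := fun u : (γ × ℕ) × ℕ => (R u.1.1).terminals.any fun c =>
    !(R u.1.1).joined (x u.1.1) (y u.1.1) u.1.2 u.2 &&
    (!(R u.1.1).joined (x u.1.1) (y u.1.1) u.1.2 c &&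
      !(R u.1.1).joined (x u.1.1) (y u.1.1) u.2 c)) ?_ (by fun_prop)
  exact any (f := fun v : ((γ × ℕ) × ℕ) × ℕ =>
    !(R v.1.1.1).joined (x v.1.1.1) (y v.1.1.1) v.1.1.2 v.1.2 &&
    (!(R v.1.1.1).joined (x v.1.1.1) (y v.1.1.1) v.1.1.2 v.2 &&
      !(R v.1.1.1).joined (x v.1.1.1) (y v.1.1.1) v.1.2 v.2)) (by fun_prop) (by fun_prop)

@[fun_prop]
theorem refuse (hR : PolyTime R) : PolyTime fun c => (R c).refuse := by
  unfold Raw.refuse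
  refine any (f := fun z : γ × ℕ => (List.range (R z.1).order).any fun y =>
    (R z.1).adj z.2 y && (decide ((R z.1).blockSize z.2 y ≤ (R z.1).demand z.2 y) &&
      !(R z.1).spread z.2 y)) ?_ (by fun_prop)
  exact any (f := fun u : (γ × ℕ) × ℕ =>
    (R u.1.1).adj u.1.2 u.2 && (decide ((R u.1.1).blockSize u.1.2 u.2 ≤
      (R u.1.1).demand u.1.2 u.2) && !(R u.1.1).spread u.1.2 u.2)) (by fun_prop) (by fun_prop)

@[fun_prop]
theorem leader (hR : PolyTime R) (hx : PolyTime x) : PolyTime fun c => (R c).leader (x c) := by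
  unfold Raw.leader
  refine (headD 0).comp (filter (f := fun z : γ × ℕ =>
    EDPKernel.reaches (R z.1).order (fun i j => (R z.1).good i j) (x z.1) z.2) ?_ (by fun_prop))
  exact reaches (e := fun u : (γ × ℕ) × ℕ × ℕ => (R u.1.1).good u.2.1 u.2.2)
    (by fun_prop) (by fun_prop) (by fun_prop) (by fun_prop)

@[fun_prop]
theorem leaders (hR : PolyTime R) : PolyTime fun c => (R c).leaders := by
  unfold Raw.leaders
  exact filter (f := fun z : γ × ℕ => (R z.1).leader z.2 == z.2) (by fun_prop) (by fun_prop)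

@[fun_prop]
theorem cls (hR : PolyTime R) (hx : PolyTime x) : PolyTime fun c => (R c).cls (x c) := by
  unfold Raw.cls
  refine (headD 0).comp (filter (f := fun z : γ × ℕ =>
    (R z.1).leaders.getD z.2 0 == (R z.1).leader (x z.1)) ?_ (by fun_prop))
  exact eq (getD (by fun_prop) (by fun_prop) 0) (by fun_prop)

@[fun_prop]
theorem contractAdj (hR : PolyTime R) (ha : PolyTime a) (hb : PolyTime b) :
    PolyTime fun c => (R c).contractAdj (a c) (b c) := by
  unfold Raw.contractAdj
  refine and (by fun_prop) (any (f := fun z : γ × ℕ => (R z.1).cls z.2 == a z.1 &&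
    (List.range (R z.1).order).any fun y => (R z.1).cls y == b z.1 && (R z.1).adj z.2 y)
    (and (by fun_prop) ?_) (by fun_prop))
  exact any (f := fun u : (γ × ℕ) × ℕ => (R u.1.1).cls u.2 == b u.1.1 && (R u.1.1).adj u.1.2 u.2)
    (by fun_prop) (by fun_prop)

@[fun_prop]
theorem contract (hR : PolyTime R) : PolyTime fun c => (R c).contract := by
  unfold Raw.contract
  refine pair (map (f := fun z : γ × ℕ => (List.range (R z.1).leaders.length).map fun b =>
    (R z.1).contractAdj z.2 b) ?_ (by fun_prop)) (filter (f := fun z : γ × ℕ × ℕ =>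
      !(z.2.1 == z.2.2)) (by fun_prop) ?_)
  · exact map (f := fun u : (γ × ℕ) × ℕ => (R u.1.1).contractAdj u.1.2 u.2)
      (by fun_prop) (by fun_prop)
  · exact map (f := fun z : γ × ℕ × ℕ => ((R z.1).cls z.2.1, (R z.1).cls z.2.2))
      (by fun_prop) (by fun_prop)

theorem kernel : PolyTime Raw.kernel := by
  unfold Raw.kernel
  fun_prop

end PolyTime
end EDPKernel

namespace EDPKernel
open Enc (enc)

/-! ## Correctness of the algorithm -/

theorem headD_filter {α : Type*} {l : List α} {p : α → Bool} {a : α} (ha : a ∈ l) (hp : p a = true)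
    (d : α) : (l.filter p).headD d ∈ l ∧ p ((l.filter p).headD d) = true := by
  have : a ∈ l.filter p := List.mem_filter.2 ⟨ha, hp⟩
  rcases h : l.filter p with _ | ⟨b, m⟩
  · rw [h] at this
    cases this
  · have : b ∈ l.filter p := h ▸ List.mem_cons_self
    simpa using this

theorem length_filter_eq_card {α : Type*} (L : List α) (p : α → Bool) :
    (L.filter p).length = (Finset.univ.filter fun i : Fin L.length => p (L.get i) = true).card := by
  induction L with
  | nil => rfl
  | cons a L ih =>
    refine Eq.trans ?_ (Fin.card_filter_univ_succ fun i : Fin (L.length + 1) =>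
      p ((a :: L).get i) = true).symm
    cases h : p a
    · rw [List.filter_cons_of_neg (by simp [h]), ih, if_neg (by simp [h])]
      rfl
    · rw [List.filter_cons_of_pos h, List.length_cons, ih, if_pos (by simpa using h)]
      rfl

theorem length_filter_range {n : ℕ} (p : ℕ → Bool) (S : Set (Fin n))
    (h : ∀ w : Fin n, p w = true ↔ w ∈ S) : ((List.range n).filter p).length = S.ncard := by
  classical
  have : (List.range n).filter p =
      ((List.finRange n).filter fun w : Fin n => p w.val).map Fin.val := by
    rw [← List.map_coe_finRange_eq_range, List.filter_map]
    rfl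
  rw [this, List.length_map, Set.ncard_eq_toFinset_card']
  rw [← List.toFinset_card_of_nodup ((List.nodup_finRange n).filter _)]
  congr 1
  ext w
  simp [h]

namespace Inst

open Classical in
/-- The lists that describe an instance. -/
noncomputable def raw (I : Inst) : Raw :=
  (List.ofFn fun i => List.ofFn fun j => decide (I.graph.Adj i j),
    I.pairs.map fun p => ((p.1 : ℕ), (p.2 : ℕ)))

/-- Lets running times proved for lists apply to instances. -/
theorem enc_raw (I : Inst) : enc I.raw = I.encode := by
  have h1 : ∀ p : Prop, ∀ [Decidable p], enc (decide p) = Data.ofProp p := by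
    intro p _
    by_cases h : p <;> simp [h, enc, Data.ofProp]
  simp only [raw, encode, enc_pair]
  congr 1
  · change Data.ofList _ = _
    rw [List.map_ofFn]
    congr 2
    funext i
    change Data.ofList _ = _
    rw [List.map_ofFn]
    congr 2
    funext j
    exact @h1 _ (Classical.propDecidable _)
  · change Data.ofList _ = _
    rw [List.map_map]
    rfl

variable (I : Inst)

theorem order_raw : I.raw.order = I.n := by simp [raw, Raw.order]

theorem adj_raw (i j : Fin I.n) : I.raw.adj i j = true ↔ I.graph.Adj i j := by
  simp [raw, Raw.adj]

theorem exists_lt_order {P : ℕ → Bool} :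
    (List.range I.raw.order).any P = true ↔ ∃ x : Fin I.n, P x = true := by
  simp only [List.any_eq_true, List.mem_range, order_raw]
  exact ⟨fun ⟨x, hx, h⟩ => ⟨⟨x, hx⟩, h⟩, fun ⟨x, h⟩ => ⟨x, x.2, h⟩⟩

theorem exists_terminal {P : ℕ → Bool} : I.raw.terminals.any P = true ↔
    ∃ x ∈ I.pairs.map (fun p => p.1) ++ I.pairs.map (fun p => p.2), P x = true := by
  have : I.raw.terminals =
      (I.pairs.map (fun p => p.1) ++ I.pairs.map (fun p => p.2)).map Fin.val := by
    simp [Raw.terminals, raw, Function.comp_def]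
  rw [this, List.any_map, List.any_eq_true]
  rfl

/-! ### The algorithm in terms of the decomposition -/

section Blocks

variable {I} {ι : Type*} (D : BlockDecomp I.graph ι) {b : ι} {x y : Fin I.n}
include D

theorem inBlock_raw (hxy : x ≠ y) (hx : x ∈ D.C b) (hy : y ∈ D.C b) (w : Fin I.n) :
    I.raw.inBlock x y w = true ↔ w ∈ D.C b := by
  rw [D.mem_iff_adj hxy hx hy]
  simp only [Raw.inBlock, Bool.and_eq_true, Bool.or_eq_true, beq_iff_eq, adj_raw, Fin.val_inj]

theorem joined_raw (hxy : x ≠ y) (hx : x ∈ D.C b) (hy : y ∈ D.C b) (s t : Fin I.n) :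
    I.raw.joined x y s t = true ↔ D.proj b s = D.proj b t := by
  rw [← D.reachable_away_iff, Raw.joined, order_raw]
  refine reaches_iff (fun i j => ?_) s t
  rw [Bool.and_eq_true, Bool.not_eq_true', ← Bool.not_eq_true, Bool.and_eq_true, adj_raw,
    inBlock_raw D hxy hx hy, inBlock_raw D hxy hx hy]
  rfl

theorem blockSize_raw (hxy : x ≠ y) (hx : x ∈ D.C b) (hy : y ∈ D.C b) :
    I.raw.blockSize x y = (D.C b).ncard := by
  rw [Raw.blockSize, order_raw]
  exact length_filter_range _ _ (inBlock_raw D hxy hx hy)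

/-- The number of demands that need an edge of the block. -/
noncomputable def demandAt (b : ι) : ℕ := (Finset.univ.filter fun i : Fin I.pairs.length =>
  D.proj b (I.pairs.get i).1 ≠ D.proj b (I.pairs.get i).2).card

theorem demand_raw (hxy : x ≠ y) (hx : x ∈ D.C b) (hy : y ∈ D.C b) :
    I.raw.demand x y = demandAt D b := by
  have : I.raw.demand x y =
      (I.pairs.filter fun p => !I.raw.joined x y p.1 p.2).length := by
    rw [Raw.demand]
    conv_lhs => rw [raw]
    rw [List.filter_map, List.length_map]
    rfl
  rw [this, length_filter_eq_card, demandAt]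
  congr 1
  ext i
  rw [Finset.mem_filter, Finset.mem_filter, Bool.not_eq_true', ← Bool.not_eq_true,
    joined_raw D hxy hx hy]

theorem spread_raw (hxy : x ≠ y) (hx : x ∈ D.C b) (hy : y ∈ D.C b) :
    I.raw.spread x y = true ↔
      ∃ u ∈ I.pairs.map (fun p => p.1) ++ I.pairs.map (fun p => p.2),
      ∃ v ∈ I.pairs.map (fun p => p.1) ++ I.pairs.map (fun p => p.2),
      ∃ w ∈ I.pairs.map (fun p => p.1) ++ I.pairs.map (fun p => p.2),
        D.proj b u ≠ D.proj b v ∧ D.proj b u ≠ D.proj b w ∧ D.proj b v ≠ D.proj b w := by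
  simp only [Raw.spread, exists_terminal, Bool.and_eq_true, Bool.not_eq_true',
    ← Bool.not_eq_true, joined_raw D hxy hx hy, ne_eq]

/-- The blocks that the kernel keeps. -/
def Bad (b : ι) : Prop := (D.C b).ncard ≤ demandAt D b

/-- All edges of a block yield the same size and demand, so the test depends only on the block. -/
theorem good_raw (x y : Fin I.n) : I.raw.good x y = true ↔
    (⨆ b : {b // ¬ Bad D b}, cliqueOn (D.C b.1)).Adj x y := by
  rw [SimpleGraph.iSup_adj, Raw.good, Bool.and_eq_true, adj_raw, decide_eq_true_eq]
  constructor
  · rintro ⟨hadj, h⟩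
    obtain ⟨hxy, b, hx, hy⟩ := (D.adj_iff _ _).1 hadj
    rw [demand_raw D hxy hx hy, blockSize_raw D hxy hx hy] at h
    exact ⟨⟨b, fun h' => absurd h' (by unfold Bad; omega)⟩, hxy, hx, hy⟩
  · rintro ⟨⟨b, hb⟩, hxy, hx, hy⟩
    refine ⟨D.isClique b hx hy hxy, ?_⟩
    rw [demand_raw D hxy hx hy, blockSize_raw D hxy hx hy]
    exact not_le.1 hb

theorem reaches_good_raw (x y : Fin I.n) :
    reaches I.raw.order (fun i j => I.raw.good i j) x y = true ↔
      (⨆ b : {b // ¬ Bad D b}, cliqueOn (D.C b.1)).Reachable x y := by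
  rw [order_raw]
  exact reaches_iff (good_raw D) x y

theorem leader_spec (x : Fin I.n) : ∃ l : Fin I.n, I.raw.leader x = l ∧
    (⨆ b : {b // ¬ Bad D b}, cliqueOn (D.C b.1)).Reachable x l := by
  -- The vertex `x` passes its own filter, so the default 0 of `headD` is never used.
  have h := headD_filter (l := List.range I.raw.order)
    (p := fun y => reaches I.raw.order (fun i j => I.raw.good i j) x y) (a := (x : ℕ))
    (by rw [order_raw]; exact List.mem_range.2 x.2) ((reaches_good_raw D x x).2 .rfl) 0
  have hlt' : I.raw.leader x < I.raw.order := List.mem_range.1 h.1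
  have hlt := hlt'.trans_eq I.order_raw
  exact ⟨⟨I.raw.leader x, hlt⟩, rfl, (reaches_good_raw D x ⟨_, hlt⟩).1 h.2⟩

theorem leader_eq_iff (x y : Fin I.n) : I.raw.leader x = I.raw.leader y ↔
    (⨆ b : {b // ¬ Bad D b}, cliqueOn (D.C b.1)).Reachable x y := by
  constructor
  · intro h
    obtain ⟨l, hl, hxl⟩ := leader_spec D x
    obtain ⟨m, hm, hym⟩ := leader_spec D y
    have : l = m := Fin.ext (by omega)
    subst this
    exact hxl.trans hym.symm
  · intro h
    simp only [Raw.leader]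
    congr 1
    refine List.filter_congr fun z hz => ?_
    rw [order_raw, List.mem_range] at hz
    rw [Bool.eq_iff_iff, reaches_good_raw D x ⟨z, hz⟩, reaches_good_raw D y ⟨z, hz⟩]
    exact ⟨fun h' => h.symm.trans h', fun h' => h.trans h'⟩

theorem leader_mem (x : Fin I.n) : I.raw.leader x ∈ I.raw.leaders := by
  obtain ⟨l, hl, hxl⟩ := leader_spec D x
  rw [hl, Raw.leaders, List.mem_filter, List.mem_range, order_raw, beq_iff_eq, ← hl]
  refine ⟨hl ▸ l.2, ?_⟩
  rw [hl, ← hl]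
  conv_lhs => rw [hl]
  exact ((leader_eq_iff D x l).2 hxl).symm

theorem cls_spec (x : Fin I.n) : I.raw.cls x < I.raw.leaders.length ∧
    I.raw.leaders.getD (I.raw.cls x) 0 = I.raw.leader x := by
  obtain ⟨j, hj, hjx⟩ := List.getElem_of_mem (leader_mem D x)
  have h := headD_filter (l := List.range I.raw.leaders.length)
    (p := fun j => I.raw.leaders.getD j 0 == I.raw.leader x) (a := j)
    (List.mem_range.2 hj) (by simp [hj, hjx]) 0
  exact ⟨List.mem_range.1 h.1, beq_iff_eq.1 h.2⟩

theorem cls_eq_iff (x y : Fin I.n) : I.raw.cls x = I.raw.cls y ↔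
    (⨆ b : {b // ¬ Bad D b}, cliqueOn (D.C b.1)).Reachable x y := by
  rw [← leader_eq_iff D]
  constructor
  · intro h
    rw [← (cls_spec D x).2, ← (cls_spec D y).2, h]
  · intro h
    simp only [Raw.cls, h]

theorem exists_cls_eq {j : ℕ} (hj : j < I.raw.leaders.length) : ∃ x : Fin I.n, I.raw.cls x = j := by
  have hm := List.getElem_mem hj
  have hmem : ∀ z ∈ I.raw.leaders, z < I.n ∧ I.raw.leader z = z := by
    intro z hz
    rwa [Raw.leaders, List.mem_filter, List.mem_range, order_raw, beq_iff_eq] at hz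
  have hm' := hmem _ hm
  set a : Fin I.n := ⟨I.raw.leaders[j], hm'.1⟩
  obtain ⟨h1, h2⟩ := cls_spec D a
  refine ⟨a, ?_⟩
  have h3 : I.raw.leader a = I.raw.leaders[j] := hm'.2
  rw [h3, List.getD_eq_getElem _ _ h1] at h2
  have hnd : I.raw.leaders.Nodup := List.nodup_range.filter _
  exact (hnd.getElem_inj_iff).1 h2

end Blocks

/-- The smallest No-instance. -/
def no : Inst where
  n := 2
  graph := ⊤
  pairs := [(0, 1), (0, 1)]
  distinct := by simp

/-- The contracted instance. -/
noncomputable def contract (h : ∀ x : Fin I.n, I.raw.cls x < I.raw.leaders.length) : Inst where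
  n := I.raw.leaders.length
  graph :=
    { Adj := fun a b => a ≠ b ∧ ∃ x y : Fin I.n, (⟨I.raw.cls x, h x⟩ : Fin _) = a ∧
        (⟨I.raw.cls y, h y⟩ : Fin _) = b ∧ I.graph.Adj x y
      symm := ⟨fun _ _ ⟨hne, x, y, hx, hy, hxy⟩ => ⟨hne.symm, y, x, hy, hx, hxy.symm⟩⟩
      loopless := ⟨fun _ h => h.1 rfl⟩ }
  pairs := (I.pairs.map fun p => ((⟨I.raw.cls p.1, h p.1⟩ : Fin _),
    (⟨I.raw.cls p.2, h p.2⟩ : Fin _))).filter fun p => p.1 ≠ p.2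
  distinct := fun p hp => by simpa using (List.mem_filter.1 hp).2

open Classical in
/-- The kernelization. -/
noncomputable def kernel : Inst :=
  -- The second conjunct makes class numbers into vertices; on block graphs it holds by `cls_spec`.
  if h : I.raw.refuse = false ∧ ∀ x : Fin I.n, I.raw.cls x < I.raw.leaders.length then
    I.contract h.2
  else no

theorem raw_no : no.raw = ([[false, true], [true, false]], [(0, 1), (0, 1)]) := by
  simp [raw, no, List.ofFn_succ]

theorem raw_contract (h : ∀ x : Fin I.n, I.raw.cls x < I.raw.leaders.length) :
    (I.contract h).raw = I.raw.contract := by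
  classical
  refine Prod.ext ?_ ?_
  · simp only [raw.eq_1 (I.contract h), Raw.contract]
    have key : ∀ {α : Type} (m : ℕ) (f : ℕ → α),
        (List.range m).map f = List.ofFn fun i : Fin m => f i := by
      intro α m f
      rw [List.ofFn_eq_map, ← List.map_coe_finRange_eq_range, List.map_map]
      rfl
    simp only [key]
    refine congrArg List.ofFn (funext fun a => congrArg List.ofFn (funext fun b => ?_))
    rw [Bool.eq_iff_iff, decide_eq_true_eq, Raw.contractAdj]
    simp only [Bool.and_eq_true, Bool.not_eq_true', beq_eq_false_iff_ne, exists_lt_order,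
      beq_iff_eq, adj_raw]
    constructor
    · rintro ⟨hne, x, y, rfl, rfl, hxy⟩
      exact ⟨fun h' => hne (Fin.ext h'), x, rfl, y, rfl, hxy⟩
    · rintro ⟨hne, x, hx, y, hy, hxy⟩
      exact ⟨fun h' => hne (congrArg _ h'), x, y, Fin.ext hx, Fin.ext hy, hxy⟩
  · simp only [raw.eq_1 (I.contract h), Raw.contract]
    simp only [contract, raw.eq_1 I, List.map_map, List.filter_map]
    congr 1
    refine List.filter_congr fun p _ => ?_
    rw [Bool.eq_iff_iff]
    simp

end Inst

/-- The program acts on lists; the promise is used to show that its output describes `Inst.kernel`.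
-/
theorem polyTimeOn_kernel : PolyTimeOn (fun I => IsBlockGraph I.graph) Inst.kernel := by
  obtain ⟨p, b, hp⟩ := PolyTime.kernel
  refine ⟨p, b, fun I hI => ?_⟩
  obtain ⟨q, ⟨D⟩⟩ := exists_blockDecomp hI
  obtain ⟨t, ht, hb⟩ := hp I.raw
  refine ⟨t, ?_, by simpa only [esize, Inst.enc_raw] using hb⟩
  have h : I.kernel.raw = I.raw.kernel := by
    have hc := fun x => (Inst.cls_spec D x).1
    cases hr : I.raw.refuse
    · rw [Inst.kernel, dif_pos ⟨hr, hc⟩, Inst.raw_contract, Raw.kernel, hr]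
      rfl
    · rw [Inst.kernel, dif_neg (by simp [hr]), Inst.raw_no, Raw.kernel, hr]
      rfl
  rwa [Inst.enc_raw, ← h, Inst.enc_raw] at ht

end EDPKernel

/-! ### Equivalence and size of the kernel -/

namespace EDPKernel

/-- Contraction may identify the two terminals of a demand; such demands must be dropped from an
instance. -/
theorem routable_pairs_iff {V W : Type*} [DecidableEq W] (L : List (V × V)) (f : V → W)
    (G : SimpleGraph W) : Routable G
      (fun i => (((L.map fun p => (f p.1, f p.2)).filter fun p => p.1 ≠ p.2).get i).1)
      (fun i => (((L.map fun p => (f p.1, f p.2)).filter fun p => p.1 ≠ p.2).get i).2) ↔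
    Routable G (fun i => f (L.get i).1) (fun i => f (L.get i).2) := by
  rw [← routableList_map_iff (fun p : W × W => p.1) (fun p => p.2),
    ← routableList_map_iff (fun p : V × V => f p.1) (fun p => f p.2)]
  rw [show (fun p : W × W => (p.1, p.2)) = id from rfl, List.map_id]
  exact routableList_filter_iff _ _

namespace Inst

theorem not_isYes_no : ¬ no.IsYes := by
  rw [isYes_iff_routable]
  intro h
  have htop : no.graph = cliqueOn ((Finset.univ : Finset (Fin 2)) : Set (Fin 2)) := by
    ext u v
    change u ≠ v ↔ u ≠ v ∧ u ∈ _ ∧ v ∈ _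
    exact ⟨fun h => ⟨h, Finset.mem_univ u, Finset.mem_univ v⟩, fun h => h.1⟩
  rw [htop] at h
  have := h.card_lt (x := (0 : Fin 2)) (Finset.mem_univ _)
    (A := (Finset.univ : Finset (Fin 2))) (by
      intro i _
      fin_cases i <;> exact ⟨(by decide : (0 : Fin 2) ≠ 1), Or.inl rfl⟩)
  exact lt_irrefl _ this

/-- The decomposition of a single edge. -/
def noDecomp : BlockDecomp no.graph Unit where
  C _ := Set.univ
  proj _ x := x
  proj_mem _ _ := Set.mem_univ _
  proj_self _ _ _ := rfl
  adj_iff u v := ⟨fun h => ⟨h, (), trivial, trivial⟩, fun h => h.1⟩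
  proj_eq b b' _ _ h := absurd rfl h
  nontrivial _ := ⟨(0 : Fin 2), trivial, (1 : Fin 2), trivial, (by decide : (0 : Fin 2) ≠ 1)⟩
  connected := by
    have : Nonempty (Fin no.n) := ⟨(0 : Fin 2)⟩
    exact SimpleGraph.connected_top

variable {I : Inst} {ι : Type*} (D : BlockDecomp I.graph ι)

theorem demandAt_le (b : ι) : demandAt D b ≤ I.k :=
  (Finset.card_le_univ _).trans_eq (Fintype.card_fin _)

theorem get_fst_mem (i : Fin I.pairs.length) :
    (I.pairs.get i).1 ∈ I.pairs.map (fun p => p.1) ++ I.pairs.map (fun p => p.2) :=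
  List.mem_append_left _ (List.mem_map_of_mem (List.get_mem _ _))

theorem get_snd_mem (i : Fin I.pairs.length) :
    (I.pairs.get i).2 ∈ I.pairs.map (fun p => p.1) ++ I.pairs.map (fun p => p.2) :=
  List.mem_append_right _ (List.mem_map_of_mem (List.get_mem _ _))

theorem two_le_ncard (b : ι) : 2 ≤ (D.C b).ncard :=
  (Set.one_lt_ncard (Set.toFinite _)).2 (D.nontrivial b)

/-- All demands crossing the refused block join the same two projections, and one vertex has fewer
block edges than there are such demands. The block has two vertices, so `k` is at least 2 and the
two demands of `no` are affordable. -/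
theorem of_refuse [Finite ι] (D : BlockDecomp I.graph ι) (h : I.raw.refuse = true) : 2 ≤ I.k ∧ ¬ I.IsYes := by
  classical
  simp only [Raw.refuse, exists_lt_order, Bool.and_eq_true, adj_raw, decide_eq_true_eq,
    Bool.not_eq_true', ← Bool.not_eq_true] at h
  obtain ⟨x, y, hadj, hle, hsp⟩ := h
  obtain ⟨hxy, b, hx, hy⟩ := (D.adj_iff _ _).1 hadj
  rw [blockSize_raw D hxy hx hy, demand_raw D hxy hx hy] at hle
  rw [spread_raw D hxy hx hy] at hsp
  have h2 := two_le_ncard D b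
  refine ⟨h2.trans (hle.trans (demandAt_le D b)), fun hyes => ?_⟩
  rw [isYes_iff_routable, D.routable_iff] at hyes
  have hb := hyes b
  obtain ⟨i₀, hi₀⟩ : ∃ i₀, D.proj b (I.pairs.get i₀).1 ≠ D.proj b (I.pairs.get i₀).2 := by
    have : 0 < demandAt D b := by omega
    obtain ⟨i, hi⟩ := Finset.card_pos.1 this
    exact ⟨i, (Finset.mem_filter.1 hi).2⟩
  rw [← Set.coe_toFinset (D.C b)] at hb
  have := hb.card_lt (x := D.proj b (I.pairs.get i₀).1) (Set.mem_toFinset.2 (D.proj_mem _ _))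
    (A := Finset.univ.filter fun i : Fin I.pairs.length =>
      D.proj b (I.pairs.get i).1 ≠ D.proj b (I.pairs.get i).2) (by
    intro i hi
    have hne := (Finset.mem_filter.1 hi).2
    refine ⟨hne, ?_⟩
    by_contra hcon
    push Not at hcon
    -- If the demand avoids the first end of `i₀`, one of its ends differs from both ends of `i₀`
    -- and gives a third projection.
    by_cases h1 : D.proj b (I.pairs.get i).1 = D.proj b (I.pairs.get i₀).2
    · exact hsp ⟨_, get_fst_mem i₀, _, get_snd_mem i₀, _, get_snd_mem i, hi₀, hcon.2.symm,
        fun h => hne (h1.trans h)⟩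
    · exact hsp ⟨_, get_fst_mem i₀, _, get_snd_mem i₀, _, get_fst_mem i, hi₀, hcon.1.symm,
        fun h => h1 h.symm⟩)
  rw [← Set.ncard_eq_toFinset_card'] at this
  exact absurd hle (not_le.2 this)

theorem spread_of_bad (h : I.raw.refuse = false) {b : ι} (hb : Bad D b) :
    ∃ u ∈ I.pairs.map (fun p => p.1) ++ I.pairs.map (fun p => p.2),
    ∃ v ∈ I.pairs.map (fun p => p.1) ++ I.pairs.map (fun p => p.2),
    ∃ w ∈ I.pairs.map (fun p => p.1) ++ I.pairs.map (fun p => p.2),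
      D.proj b u ≠ D.proj b v ∧ D.proj b u ≠ D.proj b w ∧ D.proj b v ≠ D.proj b w := by
  obtain ⟨x, hx, y, hy, hxy⟩ := D.nontrivial b
  rw [← spread_raw D hxy hx hy]
  by_contra hsp
  rw [← Bool.not_eq_true] at h
  apply h
  simp only [Raw.refuse, exists_lt_order, Bool.and_eq_true, adj_raw, decide_eq_true_eq,
    Bool.not_eq_true', ← Bool.not_eq_true]
  refine ⟨x, y, D.isClique b hx hy hxy, ?_, hsp⟩
  rw [blockSize_raw D hxy hx hy, demand_raw D hxy hx hy]
  exact hb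

theorem routable_of_not_bad {b : ι} (hb : ¬ Bad D b) : Routable (cliqueOn (D.C b))
    (fun i => D.proj b (I.pairs.get i).1) (fun i => D.proj b (I.pairs.get i).2) := by
  classical
  rw [← Set.coe_toFinset (D.C b)]
  refine routable_cliqueOn _ _ _ (fun i => Set.mem_toFinset.2 (D.proj_mem _ _))
    (fun i => Set.mem_toFinset.2 (D.proj_mem _ _)) ?_
  rw [← Set.ncard_eq_toFinset_card']
  exact not_le.1 hb

/-- The decomposition of the contracted graph. -/
noncomputable def contractDecomp (h : ∀ x : Fin I.n, I.raw.cls x < I.raw.leaders.length) :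
    BlockDecomp (I.contract h).graph {b // Bad D b} :=
  D.contract (Q := fun x => (⟨I.raw.cls x, h x⟩ : Fin I.raw.leaders.length))
    (fun j => (exists_cls_eq D j.2).imp fun _ hx => Fin.ext hx)
    (fun x y => Fin.ext_iff.trans (cls_eq_iff D x y)) (fun _ _ => Iff.rfl)

variable (h : ∀ x : Fin I.n, I.raw.cls x < I.raw.leaders.length)

theorem isYes_contract_iff [Finite ι] (D : BlockDecomp I.graph ι) : (I.contract h).IsYes ↔ I.IsYes := by
  rw [isYes_iff_routable, isYes_iff_routable]
  refine (routable_pairs_iff I.pairs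
    (fun x => (⟨I.raw.cls x, h x⟩ : Fin I.raw.leaders.length)) (I.contract h).graph).trans ?_
  exact D.routable_contract_iff (bad := Bad D) (G' := (I.contract h).graph)
    (Q := fun x => (⟨I.raw.cls x, h x⟩ : Fin I.raw.leaders.length))
    (fun j => (exists_cls_eq D j.2).imp fun _ hx => Fin.ext hx)
    (fun x y => Fin.ext_iff.trans (cls_eq_iff D x y)) (fun _ _ => Iff.rfl)
    fun b hb => routable_of_not_bad D hb

theorem ncard_contractDecomp_le (b : {b // Bad D b}) :
    ((contractDecomp D h).C b).ncard ≤ I.k :=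
  (Set.ncard_image_le (Set.toFinite _)).trans (b.2.trans (demandAt_le D b.1))

/-- The count is made in the contracted graph, whose decomposition is indexed by the bad blocks. `Q`
is injective on each of them, so three distinct projections stay distinct. -/
theorem card_bad_le [Finite ι] (h : ∀ x : Fin I.n, I.raw.cls x < I.raw.leaders.length)
    (hr : I.raw.refuse = false) :
    Nat.card {b // Bad D b} ≤ 2 * I.k - 2 := by
  classical
  set L := I.pairs.map (fun p => p.1) ++ I.pairs.map (fun p => p.2) with hL
  have hlen : L.length = 2 * I.k := by
    simp [hL, Inst.k]
    omega
  by_cases hne : Nonempty {b // Bad D b}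
  swap
  · rw [not_nonempty_iff] at hne
    simp
  obtain ⟨v₀⟩ := D.connected.nonempty
  let Q : Fin I.n → Fin I.raw.leaders.length := fun x => ⟨I.raw.cls x, h x⟩
  have hQ : ∀ x y, Q x = Q y ↔ _ := fun x y => Fin.ext_iff.trans (cls_eq_iff D x y)
  rw [← hlen]
  -- The default `v₀` only makes the list of terminals total; indices below `L.length` never reach
  -- it.
  refine (contractDecomp D h).card_add_two_le (fun i => Q (L.getD i v₀)) _ fun b => ?_
  obtain ⟨u, hu, v, hv, w, hw, h1, h2, h3⟩ := spread_of_bad D hr b.2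
  have hmem : ∀ x ∈ L, Q (D.proj b.1 x) ∈ (Finset.range L.length).image
      fun i => (contractDecomp D h).proj b (Q (L.getD i v₀)) := by
    intro x hx
    obtain ⟨i, hi, rfl⟩ := List.getElem_of_mem hx
    refine Finset.mem_image.2 ⟨i, Finset.mem_range.2 hi, ?_⟩
    rw [List.getD_eq_getElem _ _ hi]
    exact D.contract_proj _ _ _ b _
  have hinj : ∀ x y, D.proj b.1 x ≠ D.proj b.1 y → Q (D.proj b.1 x) ≠ Q (D.proj b.1 y) :=
    fun x y hxy heq => hxy (D.injOn_of_contract (fun x y => (hQ x y).1) b.2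
      (D.proj_mem _ _) (D.proj_mem _ _) heq)
  exact Finset.two_lt_card.2 ⟨_, hmem u hu, _, hmem v hv, _, hmem w hw,
    hinj _ _ h1, hinj _ _ h2, hinj _ _ h3⟩

end Inst
end EDPKernel

/-! ### Assembling the kernel -/

theorem theorem4 :
    ∃ K : EDPKernel.Inst → EDPKernel.Inst,
      EDPKernel.PolyTimeOn (fun I => EDPKernel.IsBlockGraph I.graph) K ∧
      ∀ I : EDPKernel.Inst, EDPKernel.IsBlockGraph I.graph →
        EDPKernel.IsBlockGraph (K I).graph ∧
        ((K I).IsYes ↔ I.IsYes) ∧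
        (K I).k ≤ I.k ∧
        (I.k = 0 → (K I).n = 1) ∧
        (1 ≤ I.k →
          (K I).n ≤ 4 * I.k ^ 2 - 2 * I.k ∧
          {B : (K I).graph.Subgraph | EDPKernel.IsBlock (K I).graph B}.ncard ≤ 4 * I.k - 2 ∧
          ∀ B : (K I).graph.Subgraph, EDPKernel.IsBlock (K I).graph B →
            B.verts.ncard ≤ I.k) := by
  refine ⟨EDPKernel.Inst.kernel, EDPKernel.polyTimeOn_kernel, fun I hI => ?_⟩
  obtain ⟨q, ⟨D⟩⟩ := EDPKernel.exists_blockDecomp hI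
  have harith : ∀ k : ℕ, 1 ≤ k → max 1 ((2 * k - 2) * k) ≤ 4 * k ^ 2 - 2 * k := by
    intro k hk
    obtain ⟨j, rfl⟩ := Nat.exists_eq_add_of_le hk
    have e1 : 4 * (1 + j) ^ 2 = 4 * (j * j) + 8 * j + 4 := by ring
    have e2 : (2 * (1 + j) - 2) * (1 + j) = 2 * (j * j) + 2 * j := by
      rw [show 2 * (1 + j) - 2 = 2 * j by omega]
      ring
    rw [e1, e2]
    omega
  cases hr : I.raw.refuse
  · have hc := fun x => (EDPKernel.Inst.cls_spec D x).1
    have hK : I.kernel = I.contract hc := dif_pos ⟨hr, hc⟩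
    rw [hK]
    let D' := EDPKernel.Inst.contractDecomp D hc
    have hcard := EDPKernel.Inst.card_bad_le D hc hr
    have hsize := EDPKernel.Inst.ncard_contractDecomp_le D hc
    have hn : (I.contract hc).n ≤ max 1 ((2 * I.k - 2) * I.k) := by
      have := D'.card_le_max hsize
      rw [Nat.card_fin] at this
      exact this.trans (max_le_max le_rfl (Nat.mul_le_mul_right _ hcard))
    refine ⟨D'.isBlockGraph, EDPKernel.Inst.isYes_contract_iff hc D, ?_, fun hk => ?_,
      fun hk => ⟨hn.trans (harith _ hk), ?_, fun B hB => ?_⟩⟩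
    · exact (List.length_filter_le _ _).trans_eq (List.length_map _)
    · obtain ⟨v⟩ := D'.connected.nonempty
      have := v.2
      -- Without demands no block is bad, and `max 1 0` leaves a single vertex.
      rw [hk] at hn
      simp at hn
      omega
    · have := D'.ncard_blocks_le
      omega
    · rcases D'.isBlock_cases hB with ⟨b, rfl⟩ | ⟨_, hs⟩
      · exact hsize b
      -- The whole graph is one vertex, which fits because `k` is positive.
      · exact ((Set.ncard_le_one (Set.toFinite _)).2 fun a ha b hb => hs ha hb).trans hk
  · have hK : I.kernel = EDPKernel.Inst.no := dif_neg (by simp [hr])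
    rw [hK]
    obtain ⟨h2, hno⟩ := EDPKernel.Inst.of_refuse D hr
    refine ⟨EDPKernel.Inst.noDecomp.isBlockGraph,
      iff_of_false EDPKernel.Inst.not_isYes_no hno, h2, fun hk => by omega,
      fun hk => ⟨?_, ?_, fun B hB => ?_⟩⟩
    · change 2 ≤ _
      refine le_trans ?_ (harith _ hk)
      exact le_max_of_le_right (by nlinarith [show 2 ≤ 2 * I.k - 2 by omega])
    · have := EDPKernel.Inst.noDecomp.ncard_blocks_le
      rw [Nat.card_unique, max_self] at this
      exact this.trans (by omega)
    · refine le_trans ?_ h2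
      refine (Set.ncard_le_card _).trans ?_
      change Nat.card (Fin 2) ≤ 2
      simp
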